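/- Let $A\in\mathbb{R}^{d_y\times d_x}$ with $\operatorname{rank}(A)\le r$, with singular values $s_1(A)\ge s_2(A)\ge\cdots$, let $\sigma\ge 0$ and $\delta\in(0,1)$. Let $X\in\mathbb{R}^{n\times d_x}$ be a (deterministic or random) design matrix with arbitrary law, and let $E\in\mathbb{R}^{n\times d_y}$ be independent of $X$ with i.i.d. $\mathcal N(0,\sigma^2)$ entries. We observe $X$ and $Y=XA^\top+E$. Put $\hat\Sigma=\frac1n X^\top X$, let $\bar A=Y^\top X(X^\top X)^{-1}$ be the least-squares estimator, and for $\xi\ge 0$ let $\bar A(\xi)=\sum_{i:\,s_i(\bar A)\ge\xi}s_i(\bar A)\,u_iv_i^\top$ be $\bar A=\sum_i s_i(\bar A)\,u_iv_i^\top$ (singular value decomposition) with its singular values hard-thresholded at $\xi$. The T-LSE is $\hat A_n=\bar A(\xi_{\mathrm{MR}})$ with the data-driven threshold $$\xi_{\mathrm{MR}}=\frac{2\sigma\left(\sqrt{d_x}+\sqrt{d_y}+\sqrt{\log(1/\delta)}\right)}{\sqrt{n\,\lambda_{\min}(\hat\Sigma)}}.$$ Then, with probability at least $1-\delta$, $$\|\hat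 A_n-A\|_F^2\le 864\min_{0\le k\le r}\left(\frac{k\,\sigma^2\left(\bar d+\log(1/\delta)\right)}{n\,\lambda_{\min}(\hat\Sigma)}+\sum_{i>k}s_i^2(A)\right),\qquad \bar d=\max(d_x,d_y),$$ where the right-hand side is read as $+\infty$ (so that nothing is claimed) when $\hat\Sigma$ is singular. -/

import Mathlib

open MeasureTheory ProbabilityTheory
open scoped Matrix

attribute [local instance] Matrix.frobeniusNormedAddCommGroup

noncomputable section

namespace TLSE

/-- The empirical covariance matrix `Σ̂ = (1/n) Xᵀ X` of a design matrix `X` whose rows are the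
covariates `x_1, …, x_n`. -/
def empCov {n p : ℕ} (X : Matrix (Fin n) (Fin p) ℝ) : Matrix (Fin p) (Fin p) ℝ :=
  (n : ℝ)⁻¹ • (Xᵀ * X)

theorem isHermitian_gram {m p : ℕ} (B : Matrix (Fin m) (Fin p) ℝ) : (Bᵀ * B).IsHermitian := by
  simpa using Matrix.isHermitian_conjTranspose_mul_self B

theorem isHermitian_empCov {n p : ℕ} (X : Matrix (Fin n) (Fin p) ℝ) :
    (empCov X).IsHermitian := by
  simp [Matrix.IsHermitian, empCov]

/-- The smallest eigenvalue of the empirical covariance matrix. -/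
def lambdaMin {n p : ℕ} (X : Matrix (Fin n) (Fin p) ℝ) : ℝ :=
  ⨅ j, (isHermitian_empCov X).eigenvalues j

/-- The ordinary least-squares estimator `Yᵀ X (Xᵀ X)⁻¹` in the model `Y = X Aᵀ + E`. -/
def lse {n p q : ℕ} (X : Matrix (Fin n) (Fin p) ℝ) (Y : Matrix (Fin n) (Fin q) ℝ) :
    Matrix (Fin q) (Fin p) ℝ :=
  Yᵀ * X * (Xᵀ * X)⁻¹

/-- The singular values of `A` in nonincreasing order, counted with multiplicity and indexed from
zero: `singVal A i` is `s_{i+1}(A)`, and it is zero for `i ≥ min q p`. -/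
def singVal {q p : ℕ} (A : Matrix (Fin q) (Fin p) ℝ) (i : ℕ) : ℝ :=
  (Matrix.toEuclideanLin A).singularValues i

/-- An orthonormal family of right singular vectors of `B` (eigenvectors of `Bᵀ B`). -/
def rightVec {q p : ℕ} (B : Matrix (Fin q) (Fin p) ℝ) (j : Fin p) : Fin p → ℝ :=
  ⇑((isHermitian_gram B).eigenvectorBasis j)

/-- The singular value of `B` belonging to `rightVec B j` (no ordering in `j` is imposed). -/
def vecSingVal {q p : ℕ} (B : Matrix (Fin q) (Fin p) ℝ) (j : Fin p) : ℝ :=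
  √((isHermitian_gram B).eigenvalues j)

/-- The left singular vector `u_j = B v_j / s_j` of `B` (equal to zero where `s_j = 0`). -/
def leftVec {q p : ℕ} (B : Matrix (Fin q) (Fin p) ℝ) (j : Fin p) : Fin q → ℝ :=
  (vecSingVal B j)⁻¹ • (B *ᵥ rightVec B j)

/-- Singular value hard thresholding `B(ξ) = ∑_{j : s_j(B) ≥ ξ} s_j u_j v_jᵀ`. -/
def svThreshold {q p : ℕ} (ξ : ℝ) (B : Matrix (Fin q) (Fin p) ℝ) : Matrix (Fin q) (Fin p) ℝ :=
  ∑ j with ξ ≤ vecSingVal B j,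
    vecSingVal B j • Matrix.vecMulVec (leftVec B j) (rightVec B j)

/-- The threshold `ξ_MR = 2σ(√d_x + √d_y + √log(1/δ)) / √(n λ_min(Σ̂))`, where `d_x = p` and
`d_y = q`. -/
def xiMR {n p : ℕ} (q : ℕ) (σ δ : ℝ) (X : Matrix (Fin n) (Fin p) ℝ) : ℝ :=
  2 * σ * (√(p : ℝ) + √(q : ℝ) + √(Real.log (1 / δ))) / √(n * lambdaMin X)

/-- The T-LSE: the least-squares estimator with its singular values thresholded at `ξ_MR`. -/
def tLSE {n p q : ℕ} (σ δ : ℝ) (X : Matrix (Fin n) (Fin p) ℝ) (Y : Matrix (Fin n) (Fin q) ℝ) :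
    Matrix (Fin q) (Fin p) ℝ :=
  svThreshold (xiMR q σ δ X) (lse X Y)

end TLSE

end

/-! The argument separates a deterministic bound from one probabilistic event.

Deterministic part. Suppose the least-squares estimator `B` satisfies `‖B - A‖ ≤ (3/4) ξ` in
operator norm. Write the Frobenius norm of `B(ξ) - A` in the basis of right singular vectors `v_j`
of `B`. Kept directions contribute `‖(B - A) v_j‖² ≤ (9/16) ξ²` each, and if there are `m` of them,
then `A` has at least `m` singular values `≥ ξ/4`. On the span of the discarded directions `A` has
norm at most `(7/4) ξ`. Both contributions are therefore at most a multiple of `k ξ²` plus a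
multiple of the tail of `s_i(A)²`, for every `k` (`LinearMap.sum_norm_sq_sub_add_sum_norm_sq_le`,
`TLSE.norm_sq_svThreshold_sub_le`).

Probabilistic part. The error is `Eᵀ M` with `M = X (Xᵀ X)⁻¹` and `‖M‖ ≤ 1 / √(n λ_min)`. Given `X`,
the bilinear forms of `W = Eᵀ M / (σ ‖M‖)` are sub-Gaussian. Their supremum over unit vectors is
bounded by mixing instead of by a net: the exponential supermartingale-type quantity `exp (l xᵀWy -
l²|x|²|y|²/2)` is averaged over Gaussian `x`, `y`, the average has expectation at most `1`, and
Markov's inequality bounds it by `1/δ`. Shifting the Gaussians by `u`, `v` and applying Jensen turns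
this single event into a bound on `uᵀWv` for all unit `u`, `v` at once
(`ofReal_le_measure_bilin_le`). The resulting constant `3/2`, against the `2` in the threshold,
gives the factor `3/4`. -/

/-! ### Singular values of linear maps and restrictions to subspaces. -/

section SingularValues

open Module

variable {E F : Type*} [NormedAddCommGroup E] [InnerProductSpace ℝ E] [FiniteDimensional ℝ E]
  [NormedAddCommGroup F] [InnerProductSpace ℝ F] [FiniteDimensional ℝ F]

open scoped RealInnerProductSpace

/-- The right singular vectors of a linear map, in the order of its singular values. -/
noncomputable def LinearMap.rightSingularBasis (T : E →ₗ[ℝ] F) :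
    OrthonormalBasis (Fin (finrank ℝ E)) ℝ E :=
  T.isSymmetric_adjoint_comp_self.eigenvectorBasis rfl

theorem LinearMap.norm_sq_apply_eq_sum_singularValues (T : E →ₗ[ℝ] F) (x : E) :
    ‖T x‖ ^ 2 = ∑ i : Fin (finrank ℝ E), T.singularValues i ^ 2 * ⟪T.rightSingularBasis i, x⟫ ^ 2 := by
  have h1 : ‖T x‖ ^ 2 = ⟪x, (T.adjoint ∘ₗ T) x⟫ := by
    rw [LinearMap.comp_apply, LinearMap.adjoint_inner_right, real_inner_self_eq_norm_sq]
  rw [h1, ← T.rightSingularBasis.sum_inner_mul_inner]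
  refine Finset.sum_congr rfl fun i _ => ?_
  have h2 := T.isSymmetric_adjoint_comp_self.eigenvectorBasis_apply_self_apply rfl x i
  rw [OrthonormalBasis.repr_apply_apply, OrthonormalBasis.repr_apply_apply] at h2
  rw [T.sq_singularValues_fin rfl, LinearMap.rightSingularBasis, h2, real_inner_comm]
  simp only [RCLike.ofReal_real_eq_id, id_eq]
  ring

/-- A linear map that is bounded below by `a` on a subspace of dimension greater than `i` has
`i`-th singular value at least `a`. -/
theorem LinearMap.le_singularValues_of_bddBelow_on (T : E →ₗ[ℝ] F) (V : Submodule ℝ E) {a : ℝ}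
    (hV : ∀ x ∈ V, a * ‖x‖ ≤ ‖T x‖) {i : ℕ} (hi : i < finrank ℝ V) :
    a ≤ T.singularValues i := by
  rcases lt_or_ge a 0 with ha | ha
  · exact ha.le.trans (T.singularValues_nonneg i)
  have hiE : i < finrank ℝ E := hi.trans_le V.finrank_le
  let φ : V →ₗ[ℝ] (Fin i → ℝ) := LinearMap.pi fun j =>
    (innerₛₗ ℝ (T.rightSingularBasis ⟨j, j.2.trans hiE⟩)) ∘ₗ V.subtype
  -- One half of Courant–Fischer: by dimension, `V` contains a nonzero vector orthogonal to the
  -- first `i` right singular vectors.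
  have hker : LinearMap.ker φ ≠ ⊥ := LinearMap.ker_ne_bot_of_finrank_lt (by simpa using hi)
  obtain ⟨x, hx, hx0⟩ := Submodule.exists_mem_ne_zero_of_ne_bot hker
  have hzero : ∀ j : Fin (finrank ℝ E), (j : ℕ) < i → ⟪T.rightSingularBasis j, (x : E)⟫ = 0 :=
    fun j hj => congrFun (LinearMap.mem_ker.mp hx) ⟨j, hj⟩
  have hle : ‖T x‖ ^ 2 ≤ T.singularValues i ^ 2 * ‖(x : E)‖ ^ 2 := by
    rw [T.norm_sq_apply_eq_sum_singularValues, ← T.rightSingularBasis.sum_sq_inner_right x,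
      Finset.mul_sum]
    refine Finset.sum_le_sum fun j _ => ?_
    rcases lt_or_ge (j : ℕ) i with hj | hj
    · simp [hzero j hj]
    · have := T.singularValues_antitone hj
      have := T.singularValues_nonneg j
      gcongr
  have hxpos : 0 < ‖(x : E)‖ := norm_pos_iff.mpr fun h => hx0 (Subtype.ext h)
  have h1 : a * ‖(x : E)‖ ≤ T.singularValues i * ‖(x : E)‖ := by
    refine (hV x x.2).trans (le_of_sq_le_sq ?_ (mul_nonneg (T.singularValues_nonneg i) hxpos.le))
    rwa [mul_pow]
  exact le_of_mul_le_mul_right h1 hxpos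

/-- The bound `c` is spent on the indices below `k` and `g` on the rest. Since `k` may exceed `n`,
nonnegativity is needed to enlarge the index set. -/
theorem sum_fin_le_mul_add_sum_Ico {n : ℕ} {f : Fin n → ℝ} {g : ℕ → ℝ} {c : ℝ}
    (hc : ∀ i, f i ≤ c) (hg : ∀ i, f i ≤ g i) (hc0 : 0 ≤ c) (hg0 : ∀ i, 0 ≤ g i) (k : ℕ) :
    ∑ i, f i ≤ k * c + ∑ i ∈ Finset.Ico k n, g i := by
  calc ∑ i, f i ≤ ∑ i : Fin n, if (i : ℕ) < k then c else g i :=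
        Finset.sum_le_sum fun i _ => by split_ifs; exacts [hc i, hg i]
    _ = ∑ i ∈ Finset.range n, if i < k then c else g i :=
        Fin.sum_univ_eq_sum_range (fun i => if i < k then c else g i) n
    _ ≤ ∑ i ∈ Finset.range k ∪ Finset.Ico k n, if i < k then c else g i := by
        refine Finset.sum_le_sum_of_subset_of_nonneg (fun i hi => ?_) fun i _ _ => ?_
        · simp only [Finset.mem_union, Finset.mem_range, Finset.mem_Ico] at hi ⊢
          omega
        · split_ifs
          exacts [hc0, hg0 i]
    _ = k * c + ∑ i ∈ Finset.Ico k n, g i := by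
        rw [Finset.sum_union]
        · congr 1
          · rw [Finset.sum_congr rfl fun i hi => if_pos (Finset.mem_range.mp hi)]
            simp
          · exact Finset.sum_congr rfl fun i hi => if_neg (Finset.mem_Ico.mp hi).1.not_gt
        · rw [Finset.disjoint_left]
          intro i hi hi'
          exact (Finset.mem_Ico.mp hi').1.not_gt (Finset.mem_range.mp hi)

/-- If `T` has norm at most `b` on the span of the orthonormal vectors `v j`, `j ∈ K`, then the
Hilbert-Schmidt norm of its restriction is controlled by `k` times `b ^ 2` plus the tail of the
squared singular values. -/
theorem LinearMap.sum_norm_sq_le_of_bddAbove_on {ι : Type*} [Fintype ι] (T : E →ₗ[ℝ] F)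
    (v : OrthonormalBasis ι ℝ E) (K : Finset ι) {b : ℝ}
    (hK : ∀ c : ι → ℝ, ‖T (∑ j ∈ K, c j • v j)‖ ≤ b * ‖∑ j ∈ K, c j • v j‖) (k : ℕ) :
    ∑ j ∈ K, ‖T (v j)‖ ^ 2 ≤
      k * b ^ 2 + ∑ i ∈ Finset.Ico k (finrank ℝ E), T.singularValues i ^ 2 := by
  classical
  set w := T.rightSingularBasis
  let q : Fin (finrank ℝ E) → ℝ := fun i => ∑ j ∈ K, ⟪w i, v j⟫ ^ 2
  have hsum : ∑ j ∈ K, ‖T (v j)‖ ^ 2 = ∑ i : Fin (finrank ℝ E), T.singularValues i ^ 2 * q i := by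
    simp_rw [T.norm_sq_apply_eq_sum_singularValues, q, Finset.mul_sum]
    exact Finset.sum_comm
  have hq0 : ∀ i, 0 ≤ q i := fun i => Finset.sum_nonneg fun j _ => sq_nonneg _
  have hq1 : ∀ i, q i ≤ 1 := fun i => by
    calc q i ≤ ∑ j, ⟪w i, v j⟫ ^ 2 :=
          Finset.sum_le_sum_of_subset_of_nonneg (Finset.subset_univ K) fun j _ _ => sq_nonneg _
      _ = 1 := by rw [v.sum_sq_inner_left, w.norm_eq_one, one_pow]
  -- Let `x` be the projection of `w i` onto the span of the `v j`, `j ∈ K`. Then `q i` equals both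
  -- `⟪w i, x⟫` and `‖x‖²`, so `s_i² (q i)² ≤ ‖T x‖² ≤ b² q i`; divide by `q i`.
  have hqb : ∀ i : Fin (finrank ℝ E), T.singularValues i ^ 2 * q i ≤ b ^ 2 := fun i => by
    rcases (hq0 i).eq_or_lt with h0 | hpos
    · rw [← h0, mul_zero]; positivity
    set x := ∑ j ∈ K, ⟪w i, v j⟫ • v j with hx
    have hwx : ⟪w i, x⟫ = q i := by
      simp_rw [hx, inner_sum, inner_smul_right, q, sq]
    have hxx : ‖x‖ ^ 2 = q i := by
      rw [← real_inner_self_eq_norm_sq, hx, v.orthonormal.inner_sum]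
      simp [q, sq]
    have h1 : T.singularValues i ^ 2 * ⟪w i, x⟫ ^ 2 ≤ ‖T x‖ ^ 2 := by
      rw [T.norm_sq_apply_eq_sum_singularValues]
      exact Finset.single_le_sum
        (f := fun i : Fin (finrank ℝ E) => T.singularValues i ^ 2 * ⟪w i, x⟫ ^ 2)
        (fun j _ => by positivity) (Finset.mem_univ i)
    have h2 : ‖T x‖ ^ 2 ≤ b ^ 2 * q i := by
      rw [← hxx, ← mul_pow]
      exact pow_le_pow_left₀ (norm_nonneg _) (hK _) 2
    rw [hwx] at h1
    refine le_of_mul_le_mul_right ?_ hpos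
    nlinarith
  rw [hsum]
  refine sum_fin_le_mul_add_sum_Ico hqb (fun i => ?_) (sq_nonneg b) (fun i => sq_nonneg _) k
  exact mul_le_of_le_one_right (sq_nonneg _) (hq1 i)

/-- The error of projecting a perturbation `S` of `T` onto the vectors `v j`, `j ∈ J`, on whose span
`S` is at least `ξ`, while `S` is at most `ξ` on the span of the other ones. -/
theorem LinearMap.sum_norm_sq_sub_add_sum_norm_sq_le {ι : Type*} [Fintype ι] [DecidableEq ι]
    (T S : E →ₗ[ℝ] F) (v : OrthonormalBasis ι ℝ E) (J : Finset ι) {ξ : ℝ} (hξ : 0 ≤ ξ)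
    (hTS : ∀ x, ‖S x - T x‖ ≤ 3 / 4 * ξ * ‖x‖)
    (hJ : ∀ c : ι → ℝ, ξ * ‖∑ j ∈ J, c j • v j‖ ≤ ‖S (∑ j ∈ J, c j • v j)‖)
    (hJc : ∀ c : ι → ℝ, ‖S (∑ j ∈ Jᶜ, c j • v j)‖ ≤ ξ * ‖∑ j ∈ Jᶜ, c j • v j‖) (k : ℕ) :
    ∑ j ∈ J, ‖S (v j) - T (v j)‖ ^ 2 + ∑ j ∈ Jᶜ, ‖T (v j)‖ ^ 2 ≤
      k * (29 / 8 * ξ ^ 2) +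
        10 * ∑ i ∈ Finset.Ico k (finrank ℝ E), T.singularValues i ^ 2 := by
  -- Here `7/4 = 1 + 3/4`: the bound on `S` plus the perturbation.
  have h1 : ∑ j ∈ Jᶜ, ‖T (v j)‖ ^ 2 ≤ k * (7 / 4 * ξ) ^ 2 +
      ∑ i ∈ Finset.Ico k (finrank ℝ E), T.singularValues i ^ 2 := by
    refine T.sum_norm_sq_le_of_bddAbove_on v Jᶜ (fun c => ?_) k
    have h := hTS (∑ j ∈ Jᶜ, c j • v j)
    have h' := hJc c
    have h'' := norm_le_norm_add_norm_sub (S (∑ j ∈ Jᶜ, c j • v j)) (T (∑ j ∈ Jᶜ, c j • v j))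
    linarith
  have hcard : finrank ℝ (Submodule.span ℝ (v '' (J : Set ι))) = J.card := by
    rw [Set.image_eq_range]
    refine (finrank_span_eq_card (b := fun j : J => v j) ?_).trans (Fintype.card_coe J)
    exact v.orthonormal.linearIndependent.comp _ Subtype.val_injective
  -- `T` is at least `ξ - (3/4) ξ` on a subspace of dimension `J.card`.
  have hs : ∀ i < J.card, 1 / 4 * ξ ≤ T.singularValues i := fun i hi => by
    refine T.le_singularValues_of_bddBelow_on (Submodule.span ℝ (v '' (J : Set ι)))
      (fun x hx => ?_) (hcard ▸ hi)
    obtain ⟨c, rfl⟩ := (Submodule.mem_span_image_finset_iff_exists_fun' ℝ).mp hx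
    have h := hTS (∑ j ∈ J, c j • v j)
    have h' := hJ c
    have h'' := norm_le_norm_add_norm_sub' (S (∑ j ∈ J, c j • v j)) (T (∑ j ∈ J, c j • v j))
    linarith
  have h2 : ∑ j ∈ J, ‖S (v j) - T (v j)‖ ^ 2 ≤ J.card * (3 / 4 * ξ) ^ 2 := by
    rw [← nsmul_eq_mul]
    refine Finset.sum_le_card_nsmul _ _ _ fun j _ => ?_
    refine pow_le_pow_left₀ (norm_nonneg _) ((hTS _).trans_eq ?_) 2
    rw [v.norm_eq_one, mul_one]
  -- Kept directions beyond the first `k` are charged to the tail, as `(3ξ/4)² = 9 (ξ/4)² ≤ 9 s_i²`.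
  -- Together with `h1` the constants are `49/16 + 9/16 = 29/8` and `1 + 9 = 10`.
  have h3 : J.card * (3 / 4 * ξ) ^ 2 ≤ k * (3 / 4 * ξ) ^ 2 +
      ∑ i ∈ Finset.Ico k (finrank ℝ E), 9 * T.singularValues i ^ 2 := by
    have hle : J.card ≤ finrank ℝ E := hcard ▸ Submodule.finrank_le _
    calc (J.card : ℝ) * (3 / 4 * ξ) ^ 2 = ∑ _i : Fin J.card, (3 / 4 * ξ) ^ 2 := by simp
      _ ≤ k * (3 / 4 * ξ) ^ 2 + ∑ i ∈ Finset.Ico k J.card, 9 * T.singularValues i ^ 2 := by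
        refine sum_fin_le_mul_add_sum_Ico (g := fun i => 9 * T.singularValues i ^ 2)
          (fun i => le_rfl) (fun i => ?_) (sq_nonneg _) (fun i => by positivity) k
        have := hs i i.2
        nlinarith
      _ ≤ _ := by
        gcongr
  rw [← Finset.mul_sum] at h3
  linarith

end SingularValues

/-! ### Hard thresholding of a perturbed matrix. -/

namespace TLSE

open Module
open scoped RealInnerProductSpace

variable {n p q : ℕ}

theorem gram_eigenvalues_nonneg (B : Matrix (Fin q) (Fin p) ℝ) (j : Fin p) :
    0 ≤ (isHermitian_gram B).eigenvalues j := by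
  have h : (Bᵀ * B).PosSemidef := by
    simpa using Matrix.posSemidef_conjTranspose_mul_self B
  exact h.eigenvalues_nonneg j

theorem ofLp_toEuclideanLin (B : Matrix (Fin q) (Fin p) ℝ) (x : EuclideanSpace ℝ (Fin p)) :
    (B.toEuclideanLin x).ofLp = B *ᵥ x.ofLp := rfl

theorem inner_toEuclideanLin_gram (B : Matrix (Fin q) (Fin p) ℝ) (x y : EuclideanSpace ℝ (Fin p)) :
    ⟪B.toEuclideanLin x, B.toEuclideanLin y⟫ = ⟪x, (Bᵀ * B).toEuclideanLin y⟫ := by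
  simp only [EuclideanSpace.inner_eq_star_dotProduct, ofLp_toEuclideanLin,
    star_trivial, ← Matrix.mulVec_mulVec, Matrix.dotProduct_mulVec, Matrix.mulVec_transpose]

theorem toEuclideanLin_gram_eigenvectorBasis (B : Matrix (Fin q) (Fin p) ℝ) (j : Fin p) :
    (Bᵀ * B).toEuclideanLin ((isHermitian_gram B).eigenvectorBasis j) =
      (isHermitian_gram B).eigenvalues j • (isHermitian_gram B).eigenvectorBasis j := by
  apply (WithLp.ofLp_injective 2)
  simpa using (isHermitian_gram B).mulVec_eigenvectorBasis j

theorem norm_sq_toEuclideanLin_sum (B : Matrix (Fin q) (Fin p) ℝ) (J : Finset (Fin p))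
    (c : Fin p → ℝ) :
    ‖B.toEuclideanLin (∑ j ∈ J, c j • (isHermitian_gram B).eigenvectorBasis j)‖ ^ 2 =
      ∑ j ∈ J, (isHermitian_gram B).eigenvalues j * c j ^ 2 := by
  rw [← real_inner_self_eq_norm_sq, inner_toEuclideanLin_gram]
  simp_rw [map_sum, map_smul, toEuclideanLin_gram_eigenvectorBasis, smul_smul]
  rw [(isHermitian_gram B).eigenvectorBasis.orthonormal.inner_sum]
  refine Finset.sum_congr rfl fun j _ => ?_
  simp only [conj_trivial]
  ring

theorem norm_sq_sum_eigenvectorBasis (B : Matrix (Fin q) (Fin p) ℝ) (J : Finset (Fin p))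
    (c : Fin p → ℝ) :
    ‖∑ j ∈ J, c j • (isHermitian_gram B).eigenvectorBasis j‖ ^ 2 = ∑ j ∈ J, c j ^ 2 := by
  rw [← real_inner_self_eq_norm_sq, (isHermitian_gram B).eigenvectorBasis.orthonormal.inner_sum]
  simp [sq]

theorem frobenius_norm_sq (M : Matrix (Fin q) (Fin p) ℝ) : ‖M‖ ^ 2 = ∑ i, ∑ j, M i j ^ 2 := by
  rw [Matrix.frobenius_norm_def, ← Real.sqrt_eq_rpow, Real.sq_sqrt (by positivity)]
  simp

theorem frobenius_norm_sq_eq_sum_orthonormalBasis (M : Matrix (Fin q) (Fin p) ℝ)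
    (v : OrthonormalBasis (Fin p) ℝ (EuclideanSpace ℝ (Fin p))) :
    ‖M‖ ^ 2 = ∑ j, ‖M.toEuclideanLin (v j)‖ ^ 2 := by
  have h : ∀ i, ∑ j, M i j ^ 2 = ∑ k, (M.toEuclideanLin (v k) i) ^ 2 := fun i => by
    have h1 := v.sum_sq_inner_left (WithLp.toLp 2 (M i))
    rw [EuclideanSpace.real_norm_sq_eq] at h1
    simp only at h1
    rw [← h1]
    refine Finset.sum_congr rfl fun k _ => ?_
    congr 1
    simp [EuclideanSpace.inner_eq_star_dotProduct, Matrix.mulVec, dotProduct_comm]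
  simp_rw [frobenius_norm_sq, h, EuclideanSpace.real_norm_sq_eq]
  exact Finset.sum_comm

theorem vecSingVal_smul_leftVec (B : Matrix (Fin q) (Fin p) ℝ) (j : Fin p) :
    vecSingVal B j • leftVec B j = B *ᵥ rightVec B j := by
  rcases eq_or_ne (vecSingVal B j) 0 with h0 | h0
  · have h : ‖B.toEuclideanLin ((isHermitian_gram B).eigenvectorBasis j)‖ ^ 2 = 0 := by
      have h1 := norm_sq_toEuclideanLin_sum B {j} 1
      have h2 := (Real.sqrt_eq_zero (gram_eigenvalues_nonneg B j)).mp h0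
      simpa [h2] using h1
    have h3 := norm_eq_zero.mp (pow_eq_zero_iff two_ne_zero |>.mp h)
    have h4 := congrArg WithLp.ofLp h3
    rw [ofLp_toEuclideanLin] at h4
    rw [h0, zero_smul, rightVec, h4]
    rfl
  · rw [leftVec, smul_smul, mul_inv_cancel₀ h0, one_smul]

/-- Thresholding acts as `B` composed with a spectral projection of `Bᵀ B`, so left singular vectors
play no further role. -/
theorem svThreshold_toEuclideanLin (ξ : ℝ) (B : Matrix (Fin q) (Fin p) ℝ) (j : Fin p) :
    (svThreshold ξ B).toEuclideanLin ((isHermitian_gram B).eigenvectorBasis j) =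
      if ξ ≤ vecSingVal B j then B.toEuclideanLin ((isHermitian_gram B).eigenvectorBasis j)
      else 0 := by
  have h : ∀ i, rightVec B i ⬝ᵥ rightVec B j = if i = j then 1 else 0 := fun i => by
    have := orthonormal_iff_ite.mp (isHermitian_gram B).eigenvectorBasis.orthonormal j i
    simpa [rightVec, EuclideanSpace.inner_eq_star_dotProduct, eq_comm] using this
  apply WithLp.ofLp_injective 2
  rw [ofLp_toEuclideanLin, svThreshold, Matrix.sum_mulVec]
  change ∑ i with ξ ≤ vecSingVal B i, (vecSingVal B i •
    Matrix.vecMulVec (leftVec B i) (rightVec B i)) *ᵥ rightVec B j = _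
  simp_rw [Matrix.smul_mulVec, Matrix.vecMulVec_mulVec, h]
  rw [Finset.sum_filter]
  rw [Finset.sum_eq_single j]
  · rw [if_pos rfl]
    split_ifs
    · simp [vecSingVal_smul_leftVec, rightVec]
    · simp
  · intro i _ hij
    simp [hij]
  · simp

/-- Deterministic error bound for singular value thresholding of a perturbation of `A`. -/
theorem norm_sq_svThreshold_sub_le (A B : Matrix (Fin q) (Fin p) ℝ) {ξ : ℝ} (hξ : 0 ≤ ξ)
    (hAB : ∀ x : EuclideanSpace ℝ (Fin p),
      ‖(B - A).toEuclideanLin x‖ ≤ 3 / 4 * ξ * ‖x‖) (k : ℕ) :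
    ‖svThreshold ξ B - A‖ ^ 2 ≤
      k * (29 / 8 * ξ ^ 2) + 10 * ∑ i ∈ Finset.Ico k (min p q), singVal A i ^ 2 := by
  set v := (isHermitian_gram B).eigenvectorBasis with hv
  let J : Finset (Fin p) := Finset.univ.filter fun j => ξ ≤ vecSingVal B j
  have hsq : ∀ j, vecSingVal B j ^ 2 = (isHermitian_gram B).eigenvalues j := fun j =>
    Real.sq_sqrt (gram_eigenvalues_nonneg B j)
  have hmain := LinearMap.sum_norm_sq_sub_add_sum_norm_sq_le A.toEuclideanLin B.toEuclideanLin v J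
    hξ (fun x => by simpa using hAB x)
    (fun c => by
      refine le_of_sq_le_sq ?_ (norm_nonneg _)
      rw [mul_pow, norm_sq_sum_eigenvectorBasis, norm_sq_toEuclideanLin_sum, Finset.mul_sum]
      refine Finset.sum_le_sum fun j hj => ?_
      rw [← hsq]
      have : ξ ≤ vecSingVal B j := (Finset.mem_filter.mp hj).2
      gcongr)
    (fun c => by
      refine le_of_sq_le_sq ?_ (by positivity)
      rw [mul_pow, norm_sq_sum_eigenvectorBasis, norm_sq_toEuclideanLin_sum, Finset.mul_sum]
      refine Finset.sum_le_sum fun j hj => ?_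
      rw [← hsq]
      have : vecSingVal B j ≤ ξ := by
        by_contra h
        exact Finset.mem_compl.mp hj (Finset.mem_filter.mpr ⟨Finset.mem_univ j, (not_le.mp h).le⟩)
      have : 0 ≤ vecSingVal B j := Real.sqrt_nonneg _
      gcongr) k
  -- The singular values with index at least the rank vanish, and the rank is at most `q`, so the
  -- tail may stop at `min p q`.
  have htail : ∑ i ∈ Finset.Ico k (finrank ℝ (EuclideanSpace ℝ (Fin p))),
      A.toEuclideanLin.singularValues i ^ 2 =
        ∑ i ∈ Finset.Ico k (min p q), singVal A i ^ 2 := by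
    rw [finrank_euclideanSpace_fin]
    symm
    refine Finset.sum_subset (Finset.Ico_subset_Ico_right (min_le_left _ _)) fun i hi hi' => ?_
    simp only [Finset.mem_Ico, not_and, not_lt] at hi hi'
    have h1 : finrank ℝ (LinearMap.range A.toEuclideanLin) ≤ i := by
      have h2 := Submodule.finrank_le (LinearMap.range A.toEuclideanLin)
      rw [finrank_euclideanSpace_fin] at h2
      have := hi' hi.1
      omega
    rw [singVal, (LinearMap.singularValues_eq_zero_iff_le_finrank_range _).mpr h1]
    norm_num
  rw [htail] at hmain
  refine le_trans (le_of_eq ?_) hmain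
  rw [frobenius_norm_sq_eq_sum_orthonormalBasis _ v, ← Finset.sum_add_sum_compl J]
  congr 1
  · refine Finset.sum_congr rfl fun j hj => ?_
    rw [map_sub, LinearMap.sub_apply, svThreshold_toEuclideanLin,
      if_pos (Finset.mem_filter.mp hj).2]
  · refine Finset.sum_congr rfl fun j hj => ?_
    have : ¬ ξ ≤ vecSingVal B j := fun h =>
      Finset.mem_compl.mp hj (Finset.mem_filter.mpr ⟨Finset.mem_univ j, h⟩)
    rw [map_sub, LinearMap.sub_apply, svThreshold_toEuclideanLin, if_neg this, zero_sub, norm_neg]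

end TLSE

/-! ### Translation of product Gaussian measures, and Jensen's inequality. -/

section GaussianShift

open scoped ENNReal NNReal

/-- It suffices to compare boxes, where the integral of the product density factors by independence
of the coordinates. -/
theorem pi_withDensity_eq {ι : Type*} [Fintype ι] {α : ι → Type*} [∀ i, MeasurableSpace (α i)]
    (ν : ∀ i, Measure (α i)) [∀ i, IsProbabilityMeasure (ν i)] {g : ∀ i, α i → ℝ≥0∞}
    (hg : ∀ i, Measurable (g i)) [∀ i, SigmaFinite ((ν i).withDensity (g i))] :
    Measure.pi (fun i => (ν i).withDensity (g i)) =
      (Measure.pi ν).withDensity fun x => ∏ i, g i (x i) := by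
  refine Measure.pi_eq fun s hs => ?_
  rw [withDensity_apply _ (MeasurableSet.univ_pi hs), ← lintegral_indicator (.univ_pi hs)]
  have h : ∀ x : ∀ i, α i, (Set.univ.pi s).indicator (fun x => ∏ i, g i (x i)) x =
      ∏ i, (s i).indicator (g i) (x i) := fun x => by
    by_cases hx : x ∈ Set.univ.pi s
    · rw [Set.indicator_of_mem hx]
      exact Finset.prod_congr rfl fun i _ => (Set.indicator_of_mem (hx i trivial) _).symm
    · rw [Set.indicator_of_notMem hx]
      obtain ⟨i, hi⟩ : ∃ i, x i ∉ s i := by simpa using hx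
      exact (Finset.prod_eq_zero (Finset.mem_univ i) (Set.indicator_of_notMem hi _)).symm
  simp_rw [h]
  have hind := iIndepFun_pi (μ := ν) (X := fun i => (s i).indicator (g i))
    fun i => ((hg i).indicator (hs i)).aemeasurable
  rw [lintegral_prod_eq_prod_lintegral_of_indepFun _ _ hind
    fun i => ((hg i).indicator (hs i)).comp (measurable_pi_apply i)]
  refine Finset.prod_congr rfl fun i _ => ?_
  rw [withDensity_apply _ (hs i), ← lintegral_indicator (hs i)]
  exact (measurePreserving_eval ν i).lintegral_comp ((hg i).indicator (hs i))

theorem gaussianReal_withDensity_shift {τ : ℝ≥0} (hτ : τ ≠ 0) (u : ℝ) :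
    (gaussianReal 0 τ).withDensity
      (fun x => ENNReal.ofReal (Real.exp (-(u * x) / τ - u ^ 2 / (2 * τ)))) =
      gaussianReal (-u) τ := by
  rw [gaussianReal_of_var_ne_zero _ hτ, gaussianReal_of_var_ne_zero _ hτ,
    ← withDensity_mul _ (measurable_gaussianPDF _ _) (by fun_prop)]
  congr 1
  ext x
  have hτ' : (τ : ℝ) ≠ 0 := by exact_mod_cast hτ
  rw [Pi.mul_apply, gaussianPDF, gaussianPDF, ← ENNReal.ofReal_mul (gaussianPDFReal_nonneg _ _ _),
    gaussianPDFReal, gaussianPDFReal, mul_assoc, ← Real.exp_add]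
  congr 4
  field_simp
  ring

/-- The centred Gaussian law on `Fin d → ℝ` with independent coordinates of variance `τ`. -/
noncomputable def isoGaussian (d : ℕ) (τ : ℝ≥0) : Measure (Fin d → ℝ) :=
  Measure.pi fun _ => gaussianReal 0 τ

instance (d : ℕ) (τ : ℝ≥0) : IsProbabilityMeasure (isoGaussian d τ) := by
  unfold isoGaussian; infer_instance

/-- Cameron–Martin formula in finite dimension: the exponential weight turns the centred law into
the one with mean `-u`, which translation by `u` recentres. -/
theorem lintegral_isoGaussian_shift {d : ℕ} {τ : ℝ≥0} (hτ : τ ≠ 0) (u : Fin d → ℝ)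
    {f : (Fin d → ℝ) → ℝ≥0∞} (hf : Measurable f) :
    ∫⁻ x, f x ∂(isoGaussian d τ) = ∫⁻ x, f (x + u) *
      ENNReal.ofReal (Real.exp (-(u ⬝ᵥ x) / τ - u ⬝ᵥ u / (2 * τ))) ∂(isoGaussian d τ) := by
  have h0 := fun i => gaussianReal_withDensity_shift hτ (u i)
  have : ∀ i, SigmaFinite ((gaussianReal 0 τ).withDensity
      (fun x => ENNReal.ofReal (Real.exp (-(u i * x) / τ - u i ^ 2 / (2 * τ))))) := fun i => by
    rw [h0]; infer_instance
  have h1 := pi_withDensity_eq (fun _ : Fin d => gaussianReal 0 τ)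
    (g := fun i x => ENNReal.ofReal (Real.exp (-(u i * x) / τ - u i ^ 2 / (2 * τ))))
    (fun i => by fun_prop)
  simp_rw [h0] at h1
  have h2 : (Measure.pi fun i => gaussianReal (-u i) τ).map (fun x i => x i + u i) =
      isoGaussian d τ := by
    have : ∀ i, SigmaFinite ((gaussianReal (-u i) τ).map (fun x => x + u i)) := fun i => by
      rw [gaussianReal_map_add_const]; infer_instance
    rw [Measure.pi_map_pi (μ := fun i => gaussianReal (-u i) τ) (f := fun i x => x + u i)
      fun i => by fun_prop, isoGaussian]
    simp_rw [gaussianReal_map_add_const, neg_add_cancel]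
  have h3 : ∀ x : Fin d → ℝ, ∏ i, ENNReal.ofReal
      (Real.exp (-(u i * x i) / τ - u i ^ 2 / (2 * τ))) =
      ENNReal.ofReal (Real.exp (-(u ⬝ᵥ x) / τ - u ⬝ᵥ u / (2 * τ))) := fun x => by
    rw [← ENNReal.ofReal_prod_of_nonneg fun i _ => (Real.exp_pos _).le, ← Real.exp_sum]
    congr 2
    simp only [dotProduct, Finset.sum_sub_distrib, ← Finset.sum_div, Finset.sum_neg_distrib, sq]
  conv_lhs => rw [← h2]
  rw [lintegral_map hf (by fun_prop), h1, lintegral_withDensity_eq_lintegral_mul _ (by fun_prop)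
    (by fun_prop)]
  refine lintegral_congr fun x => ?_
  rw [Pi.mul_apply, h3, mul_comm]
  rfl

theorem ofReal_exp_integral_le_lintegral {α : Type*} [MeasurableSpace α] {ν : Measure α}
    [IsProbabilityMeasure ν] {H : α → ℝ} (hH : Integrable H ν) :
    ENNReal.ofReal (Real.exp (∫ x, H x ∂ν)) ≤ ∫⁻ x, ENNReal.ofReal (Real.exp (H x)) ∂ν := by
  have hm : AEStronglyMeasurable (fun x => Real.exp (H x)) ν :=
    Real.continuous_exp.comp_aestronglyMeasurable hH.1
  have hn : 0 ≤ᵐ[ν] fun x => Real.exp (H x) := ae_of_all _ fun x => (Real.exp_pos _).le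
  by_cases hi : Integrable (fun x => Real.exp (H x)) ν
  · rw [← ofReal_integral_eq_lintegral_ofReal hi hn]
    refine ENNReal.ofReal_le_ofReal ?_
    exact convexOn_exp.map_integral_le Real.continuous_exp.continuousOn isClosed_univ
      (ae_of_all _ fun _ => trivial) hH hi
  · have : ∫⁻ x, ENNReal.ofReal (Real.exp (H x)) ∂ν = ∞ := by
      by_contra h
      exact hi ((lintegral_ofReal_ne_top_iff_integrable hm hn).mp h)
    rw [this]
    exact le_top

theorem integrable_add_eval_isoGaussian {d : ℕ} (τ : ℝ≥0) (u : Fin d → ℝ) (i : Fin d) :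
    Integrable (fun x => x i + u i) (isoGaussian d τ) := by
  have h : Integrable (fun y : ℝ => y + u i) (gaussianReal 0 τ) :=
    (IsGaussian.integrable_id (μ := gaussianReal 0 τ)).add (integrable_const _)
  exact integrable_comp_eval (μ := fun _ : Fin d => gaussianReal 0 τ) h

theorem integral_add_eval_isoGaussian {d : ℕ} (τ : ℝ≥0) (u : Fin d → ℝ) (i : Fin d) :
    ∫ x, (x i + u i) ∂(isoGaussian d τ) = u i := by
  have h := integral_comp_eval (μ := fun _ : Fin d => gaussianReal 0 τ) (i := i)
    (f := fun y : ℝ => y + u i) (by fun_prop)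
  have i1 : Integrable (fun y : ℝ => y) (gaussianReal 0 τ) := IsGaussian.integrable_id
  rw [isoGaussian, h, integral_add i1 (integrable_const _)]
  have : ∫ y, y ∂(gaussianReal 0 τ) = 0 := integral_id_gaussianReal
  simp [this]

theorem integrable_sq_add_eval_isoGaussian {d : ℕ} (τ : ℝ≥0) (u : Fin d → ℝ) (i : Fin d) :
    Integrable (fun x => (x i + u i) * (x i + u i)) (isoGaussian d τ) := by
  have h : MemLp (fun y : ℝ => y + u i) 2 (gaussianReal 0 τ) :=
    (memLp_id_gaussianReal' 2 (by simp)).add (memLp_const _)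
  exact integrable_comp_eval (μ := fun _ : Fin d => gaussianReal 0 τ)
    (f := fun y : ℝ => (y + u i) * (y + u i)) (h.integrable_mul h)

theorem integral_sq_add_eval_isoGaussian {d : ℕ} (τ : ℝ≥0) (u : Fin d → ℝ) (i : Fin d) :
    ∫ x, (x i + u i) * (x i + u i) ∂(isoGaussian d τ) = τ + u i * u i := by
  have h := integral_comp_eval (μ := fun _ : Fin d => gaussianReal 0 τ) (i := i)
    (f := fun y : ℝ => (y + u i) * (y + u i)) (by fun_prop)
  have hL : MemLp (fun y : ℝ => y) 2 (gaussianReal 0 τ) := memLp_id_gaussianReal' 2 (by simp)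
  have h1 : ∫ y, y ∂(gaussianReal 0 τ) = 0 := integral_id_gaussianReal
  have h2 : ∫ y, y ^ 2 ∂(gaussianReal 0 τ) = τ := by
    have := variance_fun_id_gaussianReal (μ := 0) (v := τ)
    rw [variance_eq_sub hL, h1] at this
    simpa using this
  have h3 : ∀ y : ℝ, (y + u i) * (y + u i) = y ^ 2 + (2 * u i * y + u i * u i) :=
    fun y => by ring
  rw [isoGaussian, h]
  simp_rw [h3]
  have i1 : Integrable (fun y : ℝ => y) (gaussianReal 0 τ) := hL.integrable one_le_two
  have i2 : Integrable (fun y : ℝ => 2 * u i * y + u i * u i) (gaussianReal 0 τ) :=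
    (i1.const_mul _).add (integrable_const _)
  rw [integral_add hL.integrable_sq i2, integral_add (i1.const_mul _) (integrable_const _), integral_const_mul, h1, h2]
  simp

end GaussianShift

/-! ### Operator norm of a random matrix with sub-Gaussian bilinear forms. -/

section SubGaussianMatrix

open scoped ENNReal NNReal

variable {p q : ℕ}

/-- A Gaussian average of `exp (l xᵀ W y - l² |x|² |y|² / 2)` over the vectors `x` and `y`. -/
noncomputable def gaussianAverage (l : ℝ) (s t : ℝ≥0) (W : Matrix (Fin q) (Fin p) ℝ) : ℝ≥0∞ :=
  ∫⁻ x, ∫⁻ y, ENNReal.ofReal (Real.exp (l * (x ⬝ᵥ W *ᵥ y) - l ^ 2 / 2 * ((x ⬝ᵥ x) * (y ⬝ᵥ y))))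
    ∂(isoGaussian p t) ∂(isoGaussian q s)

theorem integral_dotProduct_self_add_isoGaussian {d : ℕ} (τ : ℝ≥0) (u : Fin d → ℝ) :
    ∫ x, (x + u) ⬝ᵥ (x + u) ∂(isoGaussian d τ) = d * τ + u ⬝ᵥ u := by
  simp only [dotProduct, Pi.add_apply]
  rw [integral_finsetSum _ fun i _ => integrable_sq_add_eval_isoGaussian τ u i]
  simp [integral_sq_add_eval_isoGaussian, Finset.sum_add_distrib]

theorem integrable_dotProduct_self_add_isoGaussian {d : ℕ} (τ : ℝ≥0) (u : Fin d → ℝ) :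
    Integrable (fun x => (x + u) ⬝ᵥ (x + u)) (isoGaussian d τ) :=
  integrable_finsetSum _ fun i _ => integrable_sq_add_eval_isoGaussian τ u i

theorem integrable_dotProduct_isoGaussian {d : ℕ} (τ : ℝ≥0) (u : Fin d → ℝ) :
    Integrable (fun x => u ⬝ᵥ x) (isoGaussian d τ) :=
  integrable_finsetSum _ fun i _ => by
    simpa using (integrable_add_eval_isoGaussian τ 0 i).const_mul (u i)

theorem integral_dotProduct_isoGaussian {d : ℕ} (τ : ℝ≥0) (u : Fin d → ℝ) :
    ∫ x, u ⬝ᵥ x ∂(isoGaussian d τ) = 0 := by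
  have h := fun i => integral_add_eval_isoGaussian τ (0 : Fin d → ℝ) i
  have hi := fun i => integrable_add_eval_isoGaussian τ (0 : Fin d → ℝ) i
  simp only [Pi.zero_apply, add_zero] at h hi
  simp only [dotProduct]
  rw [integral_finsetSum _ fun i _ => (hi i).const_mul _]
  simp [integral_const_mul, h]

theorem integrable_bilin_isoGaussian (s t : ℝ≥0) (W : Matrix (Fin q) (Fin p) ℝ)
    (u : Fin q → ℝ) (v : Fin p → ℝ) :
    Integrable (fun z : (Fin q → ℝ) × (Fin p → ℝ) => (z.1 + u) ⬝ᵥ W *ᵥ (z.2 + v))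
      ((isoGaussian q s).prod (isoGaussian p t)) := by
  simp only [dotProduct, Matrix.mulVec, Finset.mul_sum, Pi.add_apply]
  refine integrable_finsetSum _ fun i _ => integrable_finsetSum _ fun j _ => ?_
  have := ((integrable_add_eval_isoGaussian s u i).mul_prod
    (integrable_add_eval_isoGaussian t v j)).const_mul (W i j)
  refine this.congr (ae_of_all _ fun z => ?_)
  ring

theorem integral_bilin_isoGaussian (s t : ℝ≥0) (W : Matrix (Fin q) (Fin p) ℝ)
    (u : Fin q → ℝ) (v : Fin p → ℝ) :
    ∫ z : (Fin q → ℝ) × (Fin p → ℝ), (z.1 + u) ⬝ᵥ W *ᵥ (z.2 + v)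
      ∂((isoGaussian q s).prod (isoGaussian p t)) = u ⬝ᵥ W *ᵥ v := by
  simp only [dotProduct, Matrix.mulVec, Finset.mul_sum, Pi.add_apply]
  have h : ∀ (i : Fin q) (j : Fin p) (z : (Fin q → ℝ) × (Fin p → ℝ)),
      (z.1 i + u i) * (W i j * (z.2 j + v j)) =
        W i j * ((z.1 i + u i) * (z.2 j + v j)) := fun i j z => by ring
  simp_rw [h]
  have hi : ∀ i j, Integrable (fun z : (Fin q → ℝ) × (Fin p → ℝ) =>
      W i j * ((z.1 i + u i) * (z.2 j + v j))) ((isoGaussian q s).prod (isoGaussian p t)) :=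
    fun i j => ((integrable_add_eval_isoGaussian s u i).mul_prod
      (integrable_add_eval_isoGaussian t v j)).const_mul (W i j)
  rw [integral_finsetSum _ fun i _ => integrable_finsetSum _ fun j _ => hi i j]
  refine Finset.sum_congr rfl fun i _ => ?_
  rw [integral_finsetSum _ fun j _ => hi i j]
  refine Finset.sum_congr rfl fun j _ => ?_
  rw [integral_const_mul, integral_prod_mul (fun x : Fin q → ℝ => x i + u i)
    (fun y : Fin p → ℝ => y j + v j), integral_add_eval_isoGaussian,
    integral_add_eval_isoGaussian]
  ring

/-- Shifting the Gaussian variables by unit vectors and applying Jensen's inequality. -/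
theorem ofReal_exp_le_gaussianAverage (l : ℝ) {s t : ℝ≥0} (hs : s ≠ 0) (ht : t ≠ 0)
    (W : Matrix (Fin q) (Fin p) ℝ) {u : Fin q → ℝ} {v : Fin p → ℝ}
    (hu : u ⬝ᵥ u = 1) (hv : v ⬝ᵥ v = 1) :
    ENNReal.ofReal (Real.exp (l * (u ⬝ᵥ W *ᵥ v) - l ^ 2 / 2 * ((1 + q * s) * (1 + p * t)) -
      1 / (2 * s) - 1 / (2 * t))) ≤ gaussianAverage l s t W := by
  -- `H` is the exponent after both shifts, including the Cameron–Martin weights. Its linear terms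
  -- have mean zero, and `1/(2s)`, `1/(2t)` are the relative entropies of the shifted Gaussians.
  let H : (Fin q → ℝ) × (Fin p → ℝ) → ℝ := fun z =>
    l * ((z.1 + u) ⬝ᵥ W *ᵥ (z.2 + v)) -
      l ^ 2 / 2 * (((z.1 + u) ⬝ᵥ (z.1 + u)) * ((z.2 + v) ⬝ᵥ (z.2 + v))) -
      (u ⬝ᵥ z.1) / s - (v ⬝ᵥ z.2) / t - (1 / (2 * s) + 1 / (2 * t))
  set ν := (isoGaussian q s).prod (isoGaussian p t) with hν
  have i1 := (integrable_bilin_isoGaussian s t W u v).const_mul l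
  have i2 := ((integrable_dotProduct_self_add_isoGaussian s u).mul_prod
    (integrable_dotProduct_self_add_isoGaussian t v)).const_mul (l ^ 2 / 2)
  have i3 : Integrable (fun z : (Fin q → ℝ) × (Fin p → ℝ) => (u ⬝ᵥ z.1) / s) ν :=
    ((integrable_dotProduct_isoGaussian s u).comp_fst _).div_const _
  have i4 : Integrable (fun z : (Fin q → ℝ) × (Fin p → ℝ) => (v ⬝ᵥ z.2) / t) ν :=
    ((integrable_dotProduct_isoGaussian t v).comp_snd _).div_const _
  have i12 := i1.sub i2
  have i13 := i12.sub i3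
  have i14 := i13.sub i4
  have hH : Integrable H ν := i14.sub (integrable_const _)
  have e3 : ∫ z : (Fin q → ℝ) × (Fin p → ℝ), (u ⬝ᵥ z.1) / s ∂ν = 0 := by
    rw [integral_div, hν, integral_fun_fst (fun x : Fin q → ℝ => u ⬝ᵥ x),
      integral_dotProduct_isoGaussian]
    simp
  have e4 : ∫ z : (Fin q → ℝ) × (Fin p → ℝ), (v ⬝ᵥ z.2) / t ∂ν = 0 := by
    rw [integral_div, hν, integral_fun_snd (fun x : Fin p → ℝ => v ⬝ᵥ x),
      integral_dotProduct_isoGaussian]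
    simp
  have hint : ∫ z, H z ∂ν = l * (u ⬝ᵥ W *ᵥ v) - l ^ 2 / 2 * ((1 + q * s) * (1 + p * t)) -
      1 / (2 * s) - 1 / (2 * t) := by
    have hsub : H = (fun z : (Fin q → ℝ) × (Fin p → ℝ) => l * ((z.1 + u) ⬝ᵥ W *ᵥ (z.2 + v))) -
        (fun z => l ^ 2 / 2 * (((z.1 + u) ⬝ᵥ (z.1 + u)) * ((z.2 + v) ⬝ᵥ (z.2 + v)))) -
        (fun z => (u ⬝ᵥ z.1) / s) - (fun z => (v ⬝ᵥ z.2) / t) -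
        fun _ => (1 / (2 * s) + 1 / (2 * t) : ℝ) := rfl
    rw [hsub, integral_sub' i14 (integrable_const _), integral_sub' i13 i4, integral_sub' i12 i3,
      integral_sub' i1 i2, e3, e4, integral_const_mul, integral_const_mul,
      integral_bilin_isoGaussian,
      integral_prod_mul (fun x : Fin q → ℝ => (x + u) ⬝ᵥ (x + u))
        (fun y : Fin p → ℝ => (y + v) ⬝ᵥ (y + v)),
      integral_dotProduct_self_add_isoGaussian, integral_dotProduct_self_add_isoGaussian, hu, hv]
    simp
    ring
  rw [← hint]
  refine (ofReal_exp_integral_le_lintegral hH).trans_eq ?_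
  have hm : Measurable fun z : (Fin q → ℝ) × (Fin p → ℝ) => ENNReal.ofReal (Real.exp (H z)) := by
    simp only [H, dotProduct, Matrix.mulVec]
    fun_prop
  have hmg : Measurable fun z : (Fin q → ℝ) × (Fin p → ℝ) => ENNReal.ofReal (Real.exp
      (l * (z.1 ⬝ᵥ W *ᵥ z.2) - l ^ 2 / 2 * ((z.1 ⬝ᵥ z.1) * (z.2 ⬝ᵥ z.2)))) := by
    simp only [dotProduct, Matrix.mulVec]
    fun_prop
  rw [hν, lintegral_prod _ hm.aemeasurable, gaussianAverage,
    lintegral_isoGaussian_shift hs u hmg.lintegral_prod_right']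
  refine lintegral_congr fun x => ?_
  have hy := lintegral_isoGaussian_shift ht v
    (hmg.comp (measurable_prodMk_left (x := x + u)))
  simp only [Function.comp_def] at hy
  dsimp only
  rw [hy, ← lintegral_mul_const]
  · refine lintegral_congr fun y => ?_
    rw [← ENNReal.ofReal_mul (Real.exp_pos _).le, ← ENNReal.ofReal_mul (by positivity),
      ← Real.exp_add, ← Real.exp_add, hu, hv]
    congr 2
    simp only [H]
    ring
  · simp only [dotProduct, Matrix.mulVec]
    fun_prop

variable {Ω : Type*} [MeasurableSpace Ω] {μ : Measure Ω}

theorem aemeasurable_uncurry_exp_bilin {W : Ω → Matrix (Fin q) (Fin p) ℝ}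
    (hW : ∀ i j, AEMeasurable (fun ω => W ω i j) μ) (l : ℝ)
    (ν : Measure ((Fin q → ℝ) × (Fin p → ℝ))) [SFinite ν] :
    AEMeasurable (fun z : Ω × ((Fin q → ℝ) × (Fin p → ℝ)) => ENNReal.ofReal (Real.exp
      (l * (z.2.1 ⬝ᵥ W z.1 *ᵥ z.2.2) - l ^ 2 / 2 * ((z.2.1 ⬝ᵥ z.2.1) * (z.2.2 ⬝ᵥ z.2.2)))))
      (μ.prod ν) := by
  have : ∀ i j, AEMeasurable (fun z : Ω × ((Fin q → ℝ) × (Fin p → ℝ)) => W z.1 i j) (μ.prod ν) :=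
    fun i j => (hW i j).comp_fst
  simp only [dotProduct, Matrix.mulVec]
  fun_prop

theorem gaussianAverage_eq_lintegral_prod (l : ℝ) (s t : ℝ≥0) (W : Matrix (Fin q) (Fin p) ℝ) :
    gaussianAverage l s t W = ∫⁻ z, ENNReal.ofReal (Real.exp
      (l * (z.1 ⬝ᵥ W *ᵥ z.2) - l ^ 2 / 2 * ((z.1 ⬝ᵥ z.1) * (z.2 ⬝ᵥ z.2))))
      ∂((isoGaussian q s).prod (isoGaussian p t)) := by
  rw [gaussianAverage, lintegral_prod]
  simp only [dotProduct, Matrix.mulVec]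
  fun_prop

theorem aemeasurable_gaussianAverage {W : Ω → Matrix (Fin q) (Fin p) ℝ}
    (hW : ∀ i j, AEMeasurable (fun ω => W ω i j) μ) (l : ℝ) (s t : ℝ≥0) :
    AEMeasurable (fun ω => gaussianAverage l s t (W ω)) μ := by
  simp_rw [gaussianAverage_eq_lintegral_prod]
  exact (aemeasurable_uncurry_exp_bilin hW l _).lintegral_prod_right'

variable [IsProbabilityMeasure μ]

theorem lintegral_gaussianAverage_le_one {W : Ω → Matrix (Fin q) (Fin p) ℝ}
    (hW : ∀ i j, AEMeasurable (fun ω => W ω i j) μ)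
    (hexp : ∀ (x : Fin q → ℝ) (y : Fin p → ℝ),
      ∫⁻ ω, ENNReal.ofReal (Real.exp (x ⬝ᵥ W ω *ᵥ y)) ∂μ ≤
        ENNReal.ofReal (Real.exp ((x ⬝ᵥ x) * (y ⬝ᵥ y) / 2))) (l : ℝ) (s t : ℝ≥0) :
    ∫⁻ ω, gaussianAverage l s t (W ω) ∂μ ≤ 1 := by
  simp_rw [gaussianAverage_eq_lintegral_prod]
  rw [lintegral_lintegral_swap (aemeasurable_uncurry_exp_bilin hW l _)]
  refine (lintegral_mono (g := fun _ => 1) fun z => ?_).trans_eq (by simp)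
  simp_rw [sub_eq_add_neg, Real.exp_add, ENNReal.ofReal_mul (Real.exp_pos _).le]
  rw [lintegral_mul_const' _ _ ENNReal.ofReal_ne_top]
  -- At `(l x, y)` the sub-Gaussian bound is exactly cancelled by the quadratic penalty in the
  -- exponent.
  have h := hexp (l • z.1) z.2
  simp_rw [smul_dotProduct, dotProduct_smul, smul_eq_mul] at h
  refine (mul_le_mul_left h _).trans_eq ?_
  rw [← ENNReal.ofReal_mul (Real.exp_pos _).le, ← Real.exp_add, ← ENNReal.ofReal_one,
    ← Real.exp_zero]
  congr 2
  ring

/-- Operator norm bound for a random matrix all of whose bilinear forms are sub-Gaussian. -/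
theorem ofReal_le_measure_bilin_le {W : Ω → Matrix (Fin q) (Fin p) ℝ}
    (hW : ∀ i j, AEMeasurable (fun ω => W ω i j) μ)
    (hexp : ∀ (x : Fin q → ℝ) (y : Fin p → ℝ),
      ∫⁻ ω, ENNReal.ofReal (Real.exp (x ⬝ᵥ W ω *ᵥ y)) ∂μ ≤
        ENNReal.ofReal (Real.exp ((x ⬝ᵥ x) * (y ⬝ᵥ y) / 2)))
    (hp : 0 < p) (hq : 0 < q) {δ : ℝ} (hδ : δ ∈ Set.Ioo (0 : ℝ) 1) :
    ENNReal.ofReal (1 - δ) ≤ μ {ω | ∀ (u : Fin q → ℝ) (v : Fin p → ℝ), u ⬝ᵥ u = 1 → v ⬝ᵥ v = 1 →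
      u ⬝ᵥ W ω *ᵥ v ≤ 3 / 2 * (√p + √q + √(Real.log (1 / δ)))} := by
  obtain ⟨hδ0, hδ1⟩ := hδ
  have hL : 0 < Real.log (1 / δ) := Real.log_pos (by rw [lt_div_iff₀ hδ0]; linarith)
  set a := √(q : ℝ) with ha
  set b := √(p : ℝ) with hb
  set c := √(Real.log (1 / δ)) with hc
  have ha0 : 0 < a := Real.sqrt_pos.mpr (by exact_mod_cast hq)
  have hb0 : 0 < b := Real.sqrt_pos.mpr (by exact_mod_cast hp)
  have hc0 : 0 < c := Real.sqrt_pos.mpr hL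
  have ha2 : (q : ℝ) = a ^ 2 := (Real.sq_sqrt (Nat.cast_nonneg q)).symm
  have hb2 : (p : ℝ) = b ^ 2 := (Real.sq_sqrt (Nat.cast_nonneg p)).symm
  have hc2 : Real.log (1 / δ) = c ^ 2 := (Real.sq_sqrt hL.le).symm
  set N := b + a + c with hN
  have hN0 : 0 < N := by positivity
  -- With this variance the inflation `q s = a / N` is bounded while the entropy cost `1/(2s) = a N
  -- / 2` stays of order `N²`; likewise for `t`.
  let s : ℝ≥0 := ⟨1 / (a * N), by positivity⟩
  let t : ℝ≥0 := ⟨1 / (b * N), by positivity⟩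
  have hsR : (s : ℝ) = 1 / (a * N) := rfl
  have htR : (t : ℝ) = 1 / (b * N) := rfl
  have hs : s ≠ 0 := by
    rw [← NNReal.coe_ne_zero, hsR]; positivity
  have ht : t ≠ 0 := by
    rw [← NNReal.coe_ne_zero, htR]; positivity
  set K := (1 + a / N) * (1 + b / N) with hK
  have hK0 : 0 < K := by positivity
  -- This is what the final choice of `l` requires. After AM–GM on `(N + a)(N + b)` and with `N = m
  -- + c`, it compares two quartics in `m`, `c` coefficient by coefficient; the `m⁴` coefficients
  -- agree.
  have hKbound : K * (2 * c ^ 2 + (a + b) * N) ≤ 9 / 4 * N ^ 2 := by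
    have h1 : K = (N + a) * (N + b) / N ^ 2 := by rw [hK]; field_simp
    rw [h1, div_mul_eq_mul_div, div_le_iff₀ (by positivity)]
    have h2 : (N + a) * (N + b) ≤ (N + (a + b) / 2) ^ 2 := by nlinarith [sq_nonneg (a - b)]
    refine (mul_le_mul_of_nonneg_right h2 (by positivity)).trans ?_
    set m := a + b with hm
    have hm0 : 0 < m := by positivity
    have hNm : N = m + c := by rw [hN, hm]; ring
    rw [hNm]
    have h3 : 0 ≤ m ^ 3 * c := by positivity
    have h4 : 0 ≤ m ^ 2 * c ^ 2 := by positivity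
    have h5 : 0 ≤ m * c ^ 3 := by positivity
    have h6 : 0 ≤ c ^ 4 := by positivity
    linarith
  -- This makes `l K / 2 = (3/4) N`, half of the target `(3/2) N`; `hKbound` says that the remaining
  -- terms divided by `l` fit in the other half.
  set l := 3 / 2 * N / K with hl
  have hl0 : 0 < l := by positivity
  -- The exceptional event does not depend on `u`, `v`; Markov's inequality bounds its probability
  -- by `δ`.
  set S : Set Ω := {ω | ENNReal.ofReal (1 / δ) ≤ gaussianAverage l s t (W ω)}
  have hS : μ S ≤ ENNReal.ofReal δ := by
    have h1 := mul_meas_ge_le_lintegral₀ (aemeasurable_gaussianAverage hW l s t)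
      (ENNReal.ofReal (1 / δ))
    have h2 := h1.trans (lintegral_gaussianAverage_le_one hW hexp l s t)
    calc μ S = ENNReal.ofReal δ * (ENNReal.ofReal (1 / δ) * μ S) := by
          rw [← mul_assoc, ← ENNReal.ofReal_mul hδ0.le, mul_one_div_cancel hδ0.ne',
            ENNReal.ofReal_one, one_mul]
      _ ≤ ENNReal.ofReal δ * 1 := by gcongr
      _ = _ := mul_one _
  have hcompl : ENNReal.ofReal (1 - δ) ≤ μ Sᶜ := by
    rw [ENNReal.ofReal_sub _ hδ0.le, ENNReal.ofReal_one, tsub_le_iff_left]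
    calc 1 = μ (S ∪ Sᶜ) := by rw [Set.union_compl_self, measure_univ]
      _ ≤ μ S + μ Sᶜ := measure_union_le _ _
      _ ≤ _ := by gcongr
  refine hcompl.trans (measure_mono fun ω hω u v hu hv => ?_)
  have h1 := (ofReal_exp_le_gaussianAverage l hs ht (W ω) hu hv).trans_lt
    (not_le.mp hω)
  rw [ENNReal.ofReal_lt_ofReal_iff (by positivity), ← Real.exp_log (show 0 < 1 / δ by positivity),
    Real.exp_lt_exp, hsR, htR, ha2, hb2, hc2] at h1
  have e1 : 1 + a ^ 2 * (1 / (a * N)) = 1 + a / N := by field_simp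
  have e2 : 1 + b ^ 2 * (1 / (b * N)) = 1 + b / N := by field_simp
  have e3 : 1 / (2 * (1 / (a * N))) = a * N / 2 := by field_simp
  have e4 : 1 / (2 * (1 / (b * N))) = b * N / 2 := by field_simp
  rw [e1, e2, e3, e4, ← hK] at h1
  have hlK : l * K = 3 / 2 * N := by rw [hl]; field_simp
  have h2 : l * (u ⬝ᵥ W ω *ᵥ v) * K ≤ l * (3 / 2 * N) * K := by
    have h3 : l * (u ⬝ᵥ W ω *ᵥ v) * K ≤
        (c ^ 2 + l ^ 2 / 2 * K + a * N / 2 + b * N / 2) * K := by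
      gcongr
      linarith
    have h4 : l ^ 2 / 2 * K * K = 9 / 8 * N ^ 2 := by
      calc l ^ 2 / 2 * K * K = (l * K) ^ 2 / 2 := by ring
        _ = _ := by rw [hlK]; ring
    have h5 : l * (3 / 2 * N) * K = 9 / 4 * N ^ 2 := by
      calc l * (3 / 2 * N) * K = (l * K) * (3 / 2 * N) := by ring
        _ = _ := by rw [hlK]; ring
    linarith
  exact le_of_mul_le_mul_left (le_of_mul_le_mul_right h2 hK0) hl0

end SubGaussianMatrix

/-! ### The normalized least-squares error: measurability and sub-Gaussianity. -/

namespace TLSE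

open scoped ENNReal NNReal RealInnerProductSpace

variable {n p q : ℕ}

/-- The matrix `X (Xᵀ X)⁻¹`, which maps the noise to the error of the least-squares estimator. -/
noncomputable def lseWeights (X : Matrix (Fin n) (Fin p) ℝ) : Matrix (Fin n) (Fin p) ℝ :=
  X * (Xᵀ * X)⁻¹

/-- The continuous linear map between Euclidean spaces with a given matrix, as a linear map of the
matrix. -/
noncomputable def euclideanCLM : (Fin n → Fin p → ℝ) →ₗ[ℝ]
    (EuclideanSpace ℝ (Fin p) →L[ℝ] EuclideanSpace ℝ (Fin n)) :=
  LinearMap.toContinuousLinearMap.toLinearMap ∘ₗ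
    (Matrix.toEuclideanLin (𝕜 := ℝ) (m := Fin n) (n := Fin p)).toLinearMap ∘ₗ
    (Matrix.ofLinearEquiv ℝ).toLinearMap

/-- The Euclidean operator norm of `X (Xᵀ X)⁻¹`. -/
noncomputable def weightNorm (X : Matrix (Fin n) (Fin p) ℝ) : ℝ :=
  ‖euclideanCLM fun i j => lseWeights X i j‖

theorem norm_toEuclideanLin_lseWeights_le (X : Matrix (Fin n) (Fin p) ℝ)
    (y : EuclideanSpace ℝ (Fin p)) :
    ‖(lseWeights X).toEuclideanLin y‖ ≤ weightNorm X * ‖y‖ :=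
  (euclideanCLM fun i j => lseWeights X i j).le_opNorm y

theorem weightNorm_nonneg (X : Matrix (Fin n) (Fin p) ℝ) : 0 ≤ weightNorm X := norm_nonneg _

theorem measurable_matrix_det {α : Type*} [MeasurableSpace α] {m : ℕ}
    {G : α → Matrix (Fin m) (Fin m) ℝ} (hG : ∀ i j, Measurable fun a => G a i j) :
    Measurable fun a => (G a).det := by
  simp only [Matrix.det_apply]
  fun_prop

/-- By Cramer's rule the entries are polynomials divided by the determinant. Singular matrices need
no exception, since the inverse of zero is zero. -/
theorem measurable_matrix_inv {α : Type*} [MeasurableSpace α] {m : ℕ}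
    {G : α → Matrix (Fin m) (Fin m) ℝ} (hG : ∀ i j, Measurable fun a => G a i j) (i j : Fin m) :
    Measurable fun a => (G a)⁻¹ i j := by
  simp only [Matrix.inv_def, Ring.inverse_eq_inv', Matrix.smul_apply, smul_eq_mul,
    Matrix.adjugate_apply]
  refine (measurable_matrix_det hG).inv.mul (measurable_matrix_det fun k l => ?_)
  by_cases h : k = j
  · subst h
    simp
  · simpa [Matrix.updateRow_ne h] using hG k l

theorem measurable_lseWeights (i : Fin n) (j : Fin p) :
    Measurable fun X : Fin n → Fin p → ℝ => lseWeights (Matrix.of X) i j := by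
  have hG : ∀ k l : Fin p, Measurable fun X : Fin n → Fin p → ℝ =>
      ((Matrix.of X)ᵀ * Matrix.of X) k l := fun k l => by
    simp only [Matrix.mul_apply, Matrix.transpose_apply, Matrix.of_apply]
    fun_prop
  have hX : ∀ k : Fin p, Measurable fun X : Fin n → Fin p → ℝ => X i k := fun k => by fun_prop
  unfold lseWeights
  simp only [Matrix.mul_apply' (M := Matrix.of _), dotProduct]
  exact Finset.measurable_sum _ fun k _ => (hX k).mul (measurable_matrix_inv hG k j)

/-- Normalizing by an operator norm, which is continuous in the matrix, avoids any measurability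
question for `lambdaMin`; the latter enters only pointwise, through `weightNorm_le`. -/
theorem measurable_weightNorm :
    Measurable fun X : Fin n → Fin p → ℝ => weightNorm (Matrix.of X) := by
  have h : Measurable fun X : Fin n → Fin p → ℝ => fun i j => lseWeights (Matrix.of X) i j :=
    measurable_pi_lambda _ fun i => measurable_pi_lambda _ fun j => measurable_lseWeights i j
  exact ((LinearMap.continuous_of_finiteDimensional
    (euclideanCLM (n := n) (p := p))).norm.measurable).comp h

/-- The error of the least-squares estimator, divided by the noise level and the operator norm of
`X (Xᵀ X)⁻¹`. -/
noncomputable def normalizedError (σ : ℝ) (X : Matrix (Fin n) (Fin p) ℝ)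
    (E : Matrix (Fin n) (Fin q) ℝ) : Matrix (Fin q) (Fin p) ℝ :=
  (σ * weightNorm X)⁻¹ • (Eᵀ * lseWeights X)

theorem measurable_normalizedError (σ : ℝ) (i : Fin q) (j : Fin p) :
    Measurable fun z : (Fin n → Fin p → ℝ) × (Fin n → Fin q → ℝ) =>
      normalizedError σ (Matrix.of z.1) (Matrix.of z.2) i j := by
  have h1 := measurable_lseWeights (n := n) (p := p)
  have h2 := measurable_weightNorm (n := n) (p := p)
  simp only [normalizedError, Matrix.smul_apply, Matrix.mul_apply, Matrix.transpose_apply,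
    Matrix.of_apply, smul_eq_mul]
  refine ((h2.comp measurable_fst).const_mul σ).inv.mul
    (Finset.measurable_sum _ fun k _ => Measurable.mul ?_ ((h1 k j).comp measurable_fst))
  fun_prop

theorem bilin_normalizedError (σ : ℝ) (X : Matrix (Fin n) (Fin p) ℝ)
    (E : Matrix (Fin n) (Fin q) ℝ) (x : Fin q → ℝ) (y : Fin p → ℝ) :
    x ⬝ᵥ normalizedError σ X E *ᵥ y = ∑ ij : Fin n × Fin q,
      ((σ * weightNorm X)⁻¹ * (x ij.2 * (lseWeights X *ᵥ y) ij.1)) * E ij.1 ij.2 := by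
  rw [normalizedError, Matrix.smul_mulVec, dotProduct_smul, ← Matrix.mulVec_mulVec,
    Fintype.sum_prod_type_right, smul_eq_mul, dotProduct, Finset.mul_sum]
  refine Finset.sum_congr rfl fun j _ => ?_
  rw [Matrix.mulVec, dotProduct, Finset.mul_sum, Finset.mul_sum]
  refine Finset.sum_congr rfl fun i _ => ?_
  rw [Matrix.transpose_apply]
  ring

/-- The left side is the variance of the bilinear form for a fixed design. The sum of squares
factors as `|x|² |M y|²` with `M = lseWeights X`, and `|M y| ≤ ‖M‖ |y|`. If `σ ‖M‖ = 0`, the left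
side is zero by the convention on inverses. -/
theorem sum_sq_weights_le (σ : ℝ) (X : Matrix (Fin n) (Fin p) ℝ)
    (x : Fin q → ℝ) (y : Fin p → ℝ) :
    σ ^ 2 * ∑ ij : Fin n × Fin q,
      ((σ * weightNorm X)⁻¹ * (x ij.2 * (lseWeights X *ᵥ y) ij.1)) ^ 2 ≤
      (x ⬝ᵥ x) * (y ⬝ᵥ y) := by
  have hxx : 0 ≤ x ⬝ᵥ x := Finset.sum_nonneg fun i _ => mul_self_nonneg _
  have hyy : 0 ≤ y ⬝ᵥ y := Finset.sum_nonneg fun i _ => mul_self_nonneg _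
  have h1 : ∑ ij : Fin n × Fin q,
      ((σ * weightNorm X)⁻¹ * (x ij.2 * (lseWeights X *ᵥ y) ij.1)) ^ 2 =
      ((σ * weightNorm X)⁻¹) ^ 2 * ((x ⬝ᵥ x) *
        ((lseWeights X *ᵥ y) ⬝ᵥ (lseWeights X *ᵥ y))) := by
    rw [Fintype.sum_prod_type_right, dotProduct, dotProduct, Finset.sum_mul_sum, Finset.mul_sum]
    refine Finset.sum_congr rfl fun j _ => ?_
    rw [Finset.mul_sum]
    refine Finset.sum_congr rfl fun i _ => ?_
    ring
  have h2 : (lseWeights X *ᵥ y) ⬝ᵥ (lseWeights X *ᵥ y) ≤ weightNorm X ^ 2 * (y ⬝ᵥ y) := by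
    have h := pow_le_pow_left₀ (norm_nonneg _)
      (norm_toEuclideanLin_lseWeights_le X (WithLp.toLp 2 y)) 2
    rw [mul_pow, EuclideanSpace.real_norm_sq_eq, EuclideanSpace.real_norm_sq_eq] at h
    simp only [dotProduct, ← sq]
    exact h
  rcases eq_or_ne (σ * weightNorm X) 0 with h0 | h0
  · rw [h1, h0]
    simp only [inv_zero, ne_eq, OfNat.ofNat_ne_zero, not_false_eq_true, zero_pow, zero_mul, mul_zero]
    positivity
  · have hσ : σ ≠ 0 := left_ne_zero_of_mul h0
    have hw : weightNorm X ≠ 0 := right_ne_zero_of_mul h0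
    rw [h1]
    calc _ ≤ σ ^ 2 * (((σ * weightNorm X)⁻¹) ^ 2 *
          ((x ⬝ᵥ x) * (weightNorm X ^ 2 * (y ⬝ᵥ y)))) := by gcongr
      _ = _ := by field_simp

theorem lintegral_exp_mul_gaussianReal (v : ℝ≥0) (c : ℝ) :
    ∫⁻ x, ENNReal.ofReal (Real.exp (c * x)) ∂(gaussianReal 0 v) =
      ENNReal.ofReal (Real.exp (v * c ^ 2 / 2)) := by
  rw [← ofReal_integral_eq_lintegral_ofReal (integrable_exp_mul_gaussianReal c)
    (ae_of_all _ fun x => (Real.exp_pos _).le)]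
  have h := congrFun (mgf_fun_id_gaussianReal (μ := 0) (v := v)) c
  rw [mgf] at h
  rw [h, zero_mul, zero_add]

variable {Ω : Type*} [MeasurableSpace Ω] {μ : Measure Ω}

theorem lintegral_exp_sum_of_iIndepFun {ι : Type*} [Fintype ι] {Z : ι → Ω → ℝ} {v : ℝ≥0}
    (hZ : ∀ i, HasLaw (Z i) (gaussianReal 0 v) μ) (hind : iIndepFun Z μ) (c : ι → ℝ) :
    ∫⁻ ω, ENNReal.ofReal (Real.exp (∑ i, c i * Z i ω)) ∂μ =
      ENNReal.ofReal (Real.exp (v * (∑ i, c i ^ 2) / 2)) := by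
  have hlaw := hind.hasLaw_pi hZ
  have h1 : ∫⁻ ω, ENNReal.ofReal (Real.exp (∑ i, c i * Z i ω)) ∂μ =
      ∫⁻ z : ι → ℝ, ∏ i, ENNReal.ofReal (Real.exp (c i * z i))
        ∂(Measure.pi fun _ : ι => gaussianReal 0 v) := by
    rw [← hlaw.map_eq, lintegral_map' (Measurable.aemeasurable (by fun_prop)) hlaw.aemeasurable]
    refine lintegral_congr fun ω => ?_
    rw [Real.exp_sum, ENNReal.ofReal_prod_of_nonneg fun i _ => (Real.exp_pos _).le]
  have hpi := iIndepFun_pi (μ := fun _ : ι => gaussianReal 0 v)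
    (X := fun i x => ENNReal.ofReal (Real.exp (c i * x))) fun i => by fun_prop
  rw [h1, lintegral_prod_eq_prod_lintegral_of_indepFun _ _ hpi fun i => by fun_prop]
  have h2 : ∀ i, ∫⁻ z : ι → ℝ, ENNReal.ofReal (Real.exp (c i * z i))
      ∂(Measure.pi fun _ : ι => gaussianReal 0 v) =
      ENNReal.ofReal (Real.exp (v * c i ^ 2 / 2)) := fun i => by
    rw [← lintegral_exp_mul_gaussianReal]
    exact (measurePreserving_eval (fun _ : ι => gaussianReal 0 v) i).lintegral_comp
      (f := fun x => ENNReal.ofReal (Real.exp (c i * x))) (by fun_prop)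
  simp_rw [h2]
  rw [← ENNReal.ofReal_prod_of_nonneg fun i _ => (Real.exp_pos _).le, ← Real.exp_sum,
    Finset.mul_sum, Finset.sum_div]

variable [IsProbabilityMeasure μ]

/-- The normalized error of the least-squares estimator has sub-Gaussian bilinear forms. -/
theorem lintegral_exp_bilin_normalizedError_le {σ : ℝ}
    {X : Ω → Fin n → Fin p → ℝ} (hX : Measurable X) {E : Ω → Fin n → Fin q → ℝ}
    (hE : ∀ i j, HasLaw (fun ω => E ω i j) (gaussianReal 0 (σ ^ 2).toNNReal) μ)
    (hEindep : iIndepFun (fun (ij : Fin n × Fin q) ω => E ω ij.1 ij.2) μ)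
    (hXE : IndepFun X E μ) (x : Fin q → ℝ) (y : Fin p → ℝ) :
    ∫⁻ ω, ENNReal.ofReal (Real.exp
      (x ⬝ᵥ normalizedError σ (Matrix.of (X ω)) (Matrix.of (E ω)) *ᵥ y)) ∂μ ≤
      ENNReal.ofReal (Real.exp ((x ⬝ᵥ x) * (y ⬝ᵥ y) / 2)) := by
  have hEm : AEMeasurable E μ :=
    aemeasurable_pi_lambda _ fun i => aemeasurable_pi_lambda _ fun j => (hE i j).aemeasurable
  have hF : Measurable fun z : (Fin n → Fin p → ℝ) × (Fin n → Fin q → ℝ) =>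
      ENNReal.ofReal (Real.exp
        (x ⬝ᵥ normalizedError σ (Matrix.of z.1) (Matrix.of z.2) *ᵥ y)) := by
    have h := measurable_normalizedError (n := n) (p := p) (q := q) σ
    simp only [dotProduct, Matrix.mulVec]
    fun_prop
  have h1 := lintegral_map' (μ := μ) hF.aemeasurable (hX.aemeasurable.prodMk hEm)
  rw [(indepFun_iff_map_prod_eq_prod_map_map hX.aemeasurable hEm).mp hXE] at h1
  have : IsProbabilityMeasure (μ.map X) := Measure.isProbabilityMeasure_map hX.aemeasurable
  have : IsProbabilityMeasure (μ.map E) := Measure.isProbabilityMeasure_map hEm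
  -- Independence and Tonelli reduce the claim to a fixed design `X₀`, for which the bilinear form
  -- is a linear combination of independent Gaussians.
  rw [← h1, lintegral_prod _ hF.aemeasurable]
  refine (lintegral_mono (g := fun _ => ENNReal.ofReal (Real.exp ((x ⬝ᵥ x) * (y ⬝ᵥ y) / 2)))
    fun X₀ => ?_).trans_eq (by simp)
  have h2 := lintegral_map' (μ := μ) (hF.comp (measurable_prodMk_left (x := X₀))).aemeasurable hEm
  simp only [Function.comp_def] at h2
  dsimp only
  rw [h2]
  simp only [bilin_normalizedError, Matrix.of_apply]
  rw [lintegral_exp_sum_of_iIndepFun (fun ij : Fin n × Fin q => hE ij.1 ij.2) hEindep]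
  refine ENNReal.ofReal_le_ofReal (Real.exp_le_exp.mpr ?_)
  rw [Real.coe_toNNReal _ (sq_nonneg σ)]
  have := sum_sq_weights_le σ (Matrix.of X₀) x y
  linarith

end TLSE

/-! ### The smallest eigenvalue and the error bound on the good event. -/

namespace TLSE

open scoped RealInnerProductSpace

variable {n p q : ℕ}

theorem posSemidef_empCov (X : Matrix (Fin n) (Fin p) ℝ) : (empCov X).PosSemidef := by
  have h : (Xᵀ * X).PosSemidef := by
    simpa using Matrix.posSemidef_conjTranspose_mul_self X
  exact h.smul (by positivity)

theorem lambdaMin_nonneg (X : Matrix (Fin n) (Fin p) ℝ) : 0 ≤ lambdaMin X :=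
  Real.iInf_nonneg fun j => (posSemidef_empCov X).eigenvalues_nonneg j

theorem lambdaMin_pos {X : Matrix (Fin n) (Fin p) ℝ} (hp : 0 < p)
    (h : IsUnit (empCov X).det) : 0 < lambdaMin X := by
  have : Nonempty (Fin p) := ⟨⟨0, hp⟩⟩
  obtain ⟨j, hj⟩ := exists_eq_ciInf_of_finite (f := (isHermitian_empCov X).eigenvalues)
  rw [lambdaMin, ← hj]
  refine lt_of_le_of_ne ((posSemidef_empCov X).eigenvalues_nonneg j) fun h0 => h.ne_zero ?_
  rw [(isHermitian_empCov X).det_eq_prod_eigenvalues]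
  exact Finset.prod_eq_zero (Finset.mem_univ j) (by rw [← h0]; rfl)

theorem pos_of_isUnit_det_empCov {X : Matrix (Fin n) (Fin p) ℝ} (hp : 0 < p)
    (h : IsUnit (empCov X).det) : 0 < n := by
  rcases Nat.eq_zero_or_pos n with rfl | hn
  · have : Nonempty (Fin p) := ⟨⟨0, hp⟩⟩
    simp [empCov, Matrix.det_zero] at h
  · exact hn

theorem isUnit_det_gram {X : Matrix (Fin n) (Fin p) ℝ} (h : IsUnit (empCov X).det) :
    IsUnit (Xᵀ * X).det := by
  rw [empCov, Matrix.det_smul] at h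
  exact isUnit_of_mul_isUnit_right h

theorem lambdaMin_mul_norm_sq_le (X : Matrix (Fin n) (Fin p) ℝ)
    (x : EuclideanSpace ℝ (Fin p)) :
    lambdaMin X * ‖x‖ ^ 2 ≤ ⟪x, (empCov X).toEuclideanLin x⟫ := by
  set b := (isHermitian_empCov X).eigenvectorBasis
  have hb : ∀ j, (empCov X).toEuclideanLin (b j) = (isHermitian_empCov X).eigenvalues j • b j :=
    fun j => by
      apply WithLp.ofLp_injective 2
      simpa using (isHermitian_empCov X).mulVec_eigenvectorBasis j
  have hx : (empCov X).toEuclideanLin x =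
      ∑ j, (⟪b j, x⟫ * (isHermitian_empCov X).eigenvalues j) • b j := by
    conv_lhs => rw [← b.sum_repr' x]
    simp_rw [map_sum, map_smul, hb, smul_smul]
  rw [hx, inner_sum, ← b.sum_sq_inner_right x, Finset.mul_sum]
  refine Finset.sum_le_sum fun j _ => ?_
  rw [inner_smul_right, real_inner_comm x (b j)]
  have : lambdaMin X ≤ (isHermitian_empCov X).eigenvalues j := ciInf_le (Finite.bddBelow_range _) j
  nlinarith [sq_nonneg ⟪b j, x⟫]

theorem mul_lambdaMin_mul_norm_sq_le (X : Matrix (Fin n) (Fin p) ℝ)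
    (x : EuclideanSpace ℝ (Fin p)) :
    n * lambdaMin X * ‖x‖ ^ 2 ≤ ‖X.toEuclideanLin x‖ ^ 2 := by
  rw [← real_inner_self_eq_norm_sq (X.toEuclideanLin x), inner_toEuclideanLin_gram]
  rcases Nat.eq_zero_or_pos n with rfl | hn
  · rw [← inner_toEuclideanLin_gram]
    simp
  have h := lambdaMin_mul_norm_sq_le X x
  rw [empCov, map_smul, LinearMap.smul_apply, inner_smul_right] at h
  have hn' : (0 : ℝ) < n := by exact_mod_cast hn
  rw [inv_mul_eq_div, le_div_iff₀ hn'] at h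
  linarith

theorem weightNorm_le {X : Matrix (Fin n) (Fin p) ℝ} (hp : 0 < p)
    (h : IsUnit (empCov X).det) : weightNorm X ≤ 1 / √(n * lambdaMin X) := by
  have hn : (0 : ℝ) < n := by exact_mod_cast pos_of_isUnit_det_empCov hp h
  have hl := lambdaMin_pos hp h
  set c := √(n * lambdaMin X) with hc
  have hc0 : 0 < c := Real.sqrt_pos.mpr (by positivity)
  have hc2 : c ^ 2 = n * lambdaMin X := Real.sq_sqrt (by positivity)
  refine ContinuousLinearMap.opNorm_le_bound _ (by positivity) fun y => ?_
  change ‖(lseWeights X).toEuclideanLin y‖ ≤ 1 / c * ‖y‖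
  set x : EuclideanSpace ℝ (Fin p) := ((Xᵀ * X)⁻¹).toEuclideanLin y with hx
  have h1 : (lseWeights X).toEuclideanLin y = X.toEuclideanLin x := by
    apply WithLp.ofLp_injective 2
    simp [hx, lseWeights]
  have h2 : (Xᵀ * X).toEuclideanLin x = y := by
    apply WithLp.ofLp_injective 2
    simp only [hx, ofLp_toEuclideanLin, Matrix.mulVec_mulVec,
      Matrix.mul_nonsing_inv _ (isUnit_det_gram h), Matrix.one_mulVec]
  rw [h1]
  -- With `x = (Xᵀ X)⁻¹ y`, one has `‖X x‖² = ⟪x, y⟫ ≤ ‖x‖ ‖y‖`, while `c ‖x‖ ≤ ‖X x‖`; hence `c ‖X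
  -- x‖ ≤ ‖y‖`.
  have h3 : ‖X.toEuclideanLin x‖ ^ 2 ≤ ‖x‖ * ‖y‖ := by
    rw [← real_inner_self_eq_norm_sq, inner_toEuclideanLin_gram, h2]
    exact real_inner_le_norm x y
  have h4 : c * ‖x‖ ≤ ‖X.toEuclideanLin x‖ := by
    refine le_of_sq_le_sq ?_ (norm_nonneg _)
    rw [mul_pow, hc2]
    exact mul_lambdaMin_mul_norm_sq_le X x
  rw [one_div, inv_mul_eq_div, le_div_iff₀ hc0]
  rcases (norm_nonneg (X.toEuclideanLin x)).eq_or_lt with h0 | h0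
  · rw [← h0, zero_mul]
    exact norm_nonneg y
  refine le_of_mul_le_mul_left ?_ h0
  nlinarith [mul_le_mul_of_nonneg_right h4 (norm_nonneg y), mul_le_mul_of_nonneg_left h3 hc0.le]

theorem norm_toEuclideanLin_le_of_bilin_le (D : Matrix (Fin q) (Fin p) ℝ) {C : ℝ} (hC : 0 ≤ C)
    (h : ∀ (u : Fin q → ℝ) (v : Fin p → ℝ), u ⬝ᵥ u = 1 → v ⬝ᵥ v = 1 → u ⬝ᵥ D *ᵥ v ≤ C)
    (x : EuclideanSpace ℝ (Fin p)) : ‖D.toEuclideanLin x‖ ≤ C * ‖x‖ := by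
  rcases (norm_nonneg (D.toEuclideanLin x)).eq_or_lt with h0 | h0
  · rw [← h0]
    positivity
  have hx : 0 < ‖x‖ := by
    rw [norm_pos_iff]
    rintro rfl
    simp at h0
  have hunit : ∀ {d : ℕ} (z : EuclideanSpace ℝ (Fin d)), 0 < ‖z‖ →
      (‖z‖⁻¹ • z.ofLp) ⬝ᵥ (‖z‖⁻¹ • z.ofLp) = 1 := fun z hz => by
    have h1 : z.ofLp ⬝ᵥ z.ofLp = ‖z‖ ^ 2 := by
      rw [EuclideanSpace.real_norm_sq_eq]
      simp only [dotProduct, sq]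
    rw [smul_dotProduct, dotProduct_smul, h1, smul_eq_mul, smul_eq_mul]
    field_simp
  have h2 := h _ _ (hunit (D.toEuclideanLin x) h0) (hunit x hx)
  have h3 : (D.toEuclideanLin x).ofLp ⬝ᵥ D *ᵥ x.ofLp = ‖D.toEuclideanLin x‖ ^ 2 := by
    rw [EuclideanSpace.real_norm_sq_eq]
    simp only [dotProduct, sq]
    rfl
  rw [Matrix.mulVec_smul, smul_dotProduct, dotProduct_smul, h3, smul_eq_mul, smul_eq_mul] at h2
  have h4 : ‖D.toEuclideanLin x‖⁻¹ * (‖x‖⁻¹ * ‖D.toEuclideanLin x‖ ^ 2) =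
      ‖D.toEuclideanLin x‖ / ‖x‖ := by
    field_simp
  rwa [h4, div_le_iff₀ hx] at h2

theorem lse_sub_eq {X : Matrix (Fin n) (Fin p) ℝ} (h : IsUnit (empCov X).det)
    (A : Matrix (Fin q) (Fin p) ℝ) (E : Matrix (Fin n) (Fin q) ℝ) :
    lse X (X * Aᵀ + E) - A = Eᵀ * lseWeights X := by
  rw [lse, Matrix.transpose_add, Matrix.transpose_mul, Matrix.transpose_transpose, Matrix.add_mul,
    Matrix.add_mul, Matrix.mul_assoc A, Matrix.mul_assoc A,
    Matrix.mul_nonsing_inv _ (isUnit_det_gram h), Matrix.mul_one, lseWeights, Matrix.mul_assoc]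
  abel

/-- On the event that the normalized error has small operator norm, the least-squares estimator
is within `3 / 4` of the threshold from `A`. -/
theorem norm_lse_sub_le {σ δ : ℝ} (hσ : 0 ≤ σ) {X : Matrix (Fin n) (Fin p) ℝ} (hp : 0 < p)
    (h : IsUnit (empCov X).det) (A : Matrix (Fin q) (Fin p) ℝ) {E : Matrix (Fin n) (Fin q) ℝ}
    (hE0 : σ = 0 → E = 0)
    (hW : ∀ (u : Fin q → ℝ) (v : Fin p → ℝ), u ⬝ᵥ u = 1 → v ⬝ᵥ v = 1 →
      u ⬝ᵥ normalizedError σ X E *ᵥ v ≤ 3 / 2 * (√p + √q + √(Real.log (1 / δ))))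
    (x : EuclideanSpace ℝ (Fin p)) :
    ‖(lse X (X * Aᵀ + E) - A).toEuclideanLin x‖ ≤ 3 / 4 * xiMR q σ δ X * ‖x‖ := by
  have hw0 := weightNorm_nonneg X
  have hw := weightNorm_le hp h
  rw [lse_sub_eq h]
  refine norm_toEuclideanLin_le_of_bilin_le _ (by unfold xiMR; positivity) (fun u v hu hv => ?_) x
  set N := √(p : ℝ) + √(q : ℝ) + √(Real.log (1 / δ)) with hN
  have hN0 : 0 ≤ N := by positivity
  have hxi : 3 / 4 * xiMR q σ δ X = 3 / 2 * N * (σ * (1 / √(n * lambdaMin X))) := by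
    rw [xiMR]
    ring
  rw [hxi]
  have hle : 3 / 2 * N * (σ * weightNorm X) ≤ 3 / 2 * N * (σ * (1 / √(n * lambdaMin X))) := by
    gcongr
  refine le_trans ?_ hle
  -- When `σ` or `weightNorm X` is zero, the normalized error is zero by convention and `hW` carries
  -- no information; in both cases `Eᵀ M` vanishes directly.
  rcases eq_or_ne σ 0 with h0 | h0
  · simp [hE0 h0, h0]
  rcases eq_or_ne (weightNorm X) 0 with h1 | h1
  · have h2 := norm_toEuclideanLin_lseWeights_le X (WithLp.toLp 2 v)
    rw [h1, zero_mul] at h2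
    have h3 := congrArg WithLp.ofLp (norm_le_zero_iff.mp h2)
    rw [ofLp_toEuclideanLin] at h3
    rw [← Matrix.mulVec_mulVec, h3, h1]
    simp
  have h2 := hW u v hu hv
  rw [normalizedError, Matrix.smul_mulVec, dotProduct_smul, smul_eq_mul, inv_mul_eq_div,
    div_le_iff₀ (mul_pos (hσ.lt_of_ne' h0) (hw0.lt_of_ne' h1))] at h2
  exact h2

/-- Each of the three square roots is at most `√D`, so `36 = 2² · 3²`. -/
theorem sq_xiMR_le {σ δ : ℝ} (hδ : δ ∈ Set.Ioo (0 : ℝ) 1) (X : Matrix (Fin n) (Fin p) ℝ) :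
    xiMR q σ δ X ^ 2 ≤
      36 * (σ ^ 2 * ((max p q : ℕ) + Real.log (1 / δ)) / (n * lambdaMin X)) := by
  have hL : 0 ≤ Real.log (1 / δ) :=
    Real.log_nonneg (by rw [le_div_iff₀ hδ.1]; linarith [hδ.2])
  have hl := lambdaMin_nonneg X
  set D : ℝ := (max p q : ℕ) + Real.log (1 / δ) with hD
  have hp : (p : ℝ) ≤ (max p q : ℕ) := by exact_mod_cast le_max_left p q
  have hq : (q : ℝ) ≤ (max p q : ℕ) := by exact_mod_cast le_max_right p q
  have hm : (0 : ℝ) ≤ (max p q : ℕ) := Nat.cast_nonneg _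
  have hD0 : 0 ≤ D := by positivity
  have h1 : √(p : ℝ) ≤ √D := Real.sqrt_le_sqrt (by linarith)
  have h2 : √(q : ℝ) ≤ √D := Real.sqrt_le_sqrt (by linarith)
  have h3 : √(Real.log (1 / δ)) ≤ √D := Real.sqrt_le_sqrt (by linarith)
  have h4 : (√(p : ℝ) + √(q : ℝ) + √(Real.log (1 / δ))) ^ 2 ≤ 9 * D := by
    calc _ ≤ (3 * √D) ^ 2 := pow_le_pow_left₀ (by positivity) (by linarith) 2
      _ = 9 * D := by rw [mul_pow, Real.sq_sqrt hD0]; norm_num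
  rw [xiMR, div_pow, Real.sq_sqrt (by positivity), mul_pow, ← mul_div_assoc]
  refine div_le_div_of_nonneg_right ?_ (by positivity)
  linarith [mul_le_mul_of_nonneg_left h4 (sq_nonneg σ)]

/-- Deterministic error bound for the thresholded least-squares estimator, on the event that the
normalized error has small operator norm. -/
theorem norm_sq_tLSE_sub_le {σ δ : ℝ} (hσ : 0 ≤ σ) (hδ : δ ∈ Set.Ioo (0 : ℝ) 1)
    {X : Matrix (Fin n) (Fin p) ℝ} (hp : 0 < p)
    (h : IsUnit (empCov X).det) (A : Matrix (Fin q) (Fin p) ℝ) {E : Matrix (Fin n) (Fin q) ℝ}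
    (hE0 : σ = 0 → E = 0)
    (hW : ∀ (u : Fin q → ℝ) (v : Fin p → ℝ), u ⬝ᵥ u = 1 → v ⬝ᵥ v = 1 →
      u ⬝ᵥ normalizedError σ X E *ᵥ v ≤ 3 / 2 * (√p + √q + √(Real.log (1 / δ)))) (k : ℕ) :
    ‖tLSE σ δ X (X * Aᵀ + E) - A‖ ^ 2 ≤
      864 * (k * σ ^ 2 * ((max p q : ℕ) + Real.log (1 / δ)) / (n * lambdaMin X)
        + ∑ i ∈ Finset.Ico k (min p q), singVal A i ^ 2) := by
  have hL : 0 ≤ Real.log (1 / δ) :=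
    Real.log_nonneg (by rw [le_div_iff₀ hδ.1]; linarith [hδ.2])
  have hxi0 : 0 ≤ xiMR q σ δ X := by
    unfold xiMR
    positivity
  refine (norm_sq_svThreshold_sub_le A (lse X (X * Aᵀ + E)) hxi0
    (norm_lse_sub_le hσ hp h A hE0 hW) k).trans ?_
  have hsq := mul_le_mul_of_nonneg_left
    (sq_xiMR_le (q := q) (σ := σ) hδ X) (Nat.cast_nonneg (α := ℝ) k)
  have htail : 0 ≤ ∑ i ∈ Finset.Ico k (min p q), singVal A i ^ 2 :=
    Finset.sum_nonneg fun i _ => sq_nonneg _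
  have hl := lambdaMin_nonneg X
  have hterm : 0 ≤ k * (σ ^ 2 * ((max p q : ℕ) + Real.log (1 / δ)) / (n * lambdaMin X)) := by
    positivity
  have hassoc : k * σ ^ 2 * ((max p q : ℕ) + Real.log (1 / δ)) / (n * lambdaMin X) =
      k * (σ ^ 2 * ((max p q : ℕ) + Real.log (1 / δ)) / (n * lambdaMin X)) := by ring
  rw [hassoc]
  -- The constants needed are `36 · 29/8 = 130.5` for the first term and `10` for the tail, both
  -- below `864`.
  linarith

theorem norm_sq_eq_zero_of_mul_eq_zero (h : p * q = 0) (M : Matrix (Fin q) (Fin p) ℝ) :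
    ‖M‖ ^ 2 = 0 := by
  rw [frobenius_norm_sq]
  refine Finset.sum_eq_zero fun i _ => Finset.sum_eq_zero fun j _ => ?_
  exact absurd h (Nat.mul_pos j.pos i.pos).ne'

end TLSE

/-! ### Assembly of the high-probability bound. -/

theorem mainTheorem9 {Ω : Type*} [MeasurableSpace Ω] (μ : Measure Ω) [IsProbabilityMeasure μ]
    {n dx dy : ℕ} (r : ℕ) (A : Matrix (Fin dy) (Fin dx) ℝ) (hA : A.rank ≤ r)
    (σ : ℝ) (hσ : 0 ≤ σ) (δ : ℝ) (hδ : δ ∈ Set.Ioo (0 : ℝ) 1)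
    -- the design, with an arbitrary law (a deterministic design is a constant `X`)
    (X : Ω → Fin n → Fin dx → ℝ) (hX : Measurable X)
    -- the noise: i.i.d. centred Gaussian entries of variance `σ ^ 2`, independent of the design
    (E : Ω → Fin n → Fin dy → ℝ)
    (hE : ∀ i j, HasLaw (fun ω => E ω i j) (gaussianReal 0 (σ ^ 2).toNNReal) μ)
    (hEindep : iIndepFun (fun (ij : Fin n × Fin dy) ω => E ω ij.1 ij.2) μ)
    (hXE : IndepFun X E μ)
    -- the observations `y_i = A x_i + η_i`, as rows of `Y = X Aᵀ + E`
    (Y : Ω → Matrix (Fin n) (Fin dy) ℝ)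
    (hY : ∀ ω, Y ω = Matrix.of (X ω) * Aᵀ + Matrix.of (E ω)) :
    ENNReal.ofReal (1 - δ) ≤ μ {ω |
      -- where `Σ̂` is singular the right-hand side is infinite and nothing is claimed
      IsUnit (TLSE.empCov (Matrix.of (X ω))).det →
        ‖TLSE.tLSE σ δ (Matrix.of (X ω)) (Y ω) - A‖ ^ 2 ≤
          864 * (Finset.range (r + 1)).inf' Finset.nonempty_range_add_one (fun k =>
            k * σ ^ 2 * ((max dx dy : ℕ) + Real.log (1 / δ)) /
                (n * TLSE.lambdaMin (Matrix.of (X ω)))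
              + ∑ i ∈ Finset.Ico k (min dx dy), TLSE.singVal A i ^ 2)} := by
  have hL : 0 ≤ Real.log (1 / δ) :=
    Real.log_nonneg (by rw [le_div_iff₀ hδ.1]; linarith [hδ.2])
  have hreduce : ∀ ω, (∀ k : ℕ, ‖TLSE.tLSE σ δ (Matrix.of (X ω)) (Y ω) - A‖ ^ 2 ≤
      864 * (k * σ ^ 2 * ((max dx dy : ℕ) + Real.log (1 / δ)) /
        (n * TLSE.lambdaMin (Matrix.of (X ω)))
          + ∑ i ∈ Finset.Ico k (min dx dy), TLSE.singVal A i ^ 2)) →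
      ‖TLSE.tLSE σ δ (Matrix.of (X ω)) (Y ω) - A‖ ^ 2 ≤
          864 * (Finset.range (r + 1)).inf' Finset.nonempty_range_add_one (fun k =>
            k * σ ^ 2 * ((max dx dy : ℕ) + Real.log (1 / δ)) /
                (n * TLSE.lambdaMin (Matrix.of (X ω)))
              + ∑ i ∈ Finset.Ico k (min dx dy), TLSE.singVal A i ^ 2) := fun ω h => by
    rw [← div_le_iff₀' (by norm_num), Finset.le_inf'_iff]
    intro k _
    rw [div_le_iff₀' (by norm_num)]
    exact h k
  -- If a dimension is zero, all matrices have norm zero and the bound holds everywhere; the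
  -- operator norm estimate needs both dimensions positive.
  rcases Nat.eq_zero_or_pos (dx * dy) with h0 | hpos
  · refine (ENNReal.ofReal_le_one.mpr (by linarith [hδ.1])).trans_eq ?_
    rw [← measure_univ (μ := μ)]
    congr 1
    symm
    refine Set.eq_univ_of_forall fun ω => ?_
    intro _
    refine hreduce ω fun k => ?_
    have := TLSE.lambdaMin_nonneg (Matrix.of (X ω))
    rw [TLSE.norm_sq_eq_zero_of_mul_eq_zero h0]
    positivity
  have hdx : 0 < dx := Nat.pos_of_mul_pos_right hpos
  have hdy : 0 < dy := Nat.pos_of_mul_pos_left hpos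
  have hEm : AEMeasurable E μ :=
    aemeasurable_pi_lambda _ fun i => aemeasurable_pi_lambda _ fun j => (hE i j).aemeasurable
  have hXEm : AEMeasurable (fun ω => (X ω, E ω)) μ := hX.aemeasurable.prodMk hEm
  have hWm : ∀ i j, AEMeasurable (fun ω =>
      TLSE.normalizedError σ (Matrix.of (X ω)) (Matrix.of (E ω)) i j) μ := fun i j => by
    have h := (TLSE.measurable_normalizedError (n := n) (p := dx) (q := dy) σ i j).comp_aemeasurable
      hXEm
    simpa only [Function.comp_def] using h
  have hgood := ofReal_le_measure_bilin_le hWm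
    (TLSE.lintegral_exp_bilin_normalizedError_le hX hE hEindep hXE) hdx hdy hδ
  -- For `σ = 0` the noise law is a Dirac mass, so the noise vanishes only almost surely; hence the
  -- comparison of events up to a null set below.
  have hE0 : ∀ᵐ ω ∂μ, σ = 0 → Matrix.of (E ω) = 0 := by
    rcases eq_or_ne σ 0 with rfl | hσ0
    · have h1 : ∀ i j, ∀ᵐ ω ∂μ, E ω i j = 0 := fun i j => by
        have h2 := hE i j
        have h3 : ∀ᵐ x ∂(gaussianReal 0 ((0 : ℝ) ^ 2).toNNReal), x = 0 := by
          simp [ae_dirac_eq]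
        rw [← h2.map_eq] at h3
        exact ae_of_ae_map h2.aemeasurable h3
      filter_upwards [ae_all_iff.mpr fun i => ae_all_iff.mpr fun j => h1 i j] with ω hω _
      ext i j
      exact hω i j
    · exact ae_of_all _ fun ω h => absurd h hσ0
  refine hgood.trans (measure_mono_ae ?_)
  filter_upwards [hE0] with ω hω0 hω hdet
  refine hreduce ω fun k => ?_
  rw [hY]
  exact TLSE.norm_sq_tLSE_sub_le hσ hδ hdx hdet A hω0 hω k
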